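/- Let Equitable Coloring be the following problem: given a finite simple graph $G$ and a positive integer $h$, decide whether $G$ has a proper vertex coloring with at most $h$ colors such that the sizes of any two color classes differ by at most $1$. Let $k$ be the vertex cover number of $G$, that is, the smallest size of a set of vertices that meets every edge. **Theorem.** Equitable Coloring can be solved in time $2^{O(k^2)}\cdot |V(G)|^{O(1)}$. More precisely, there are a program $P$ for a random access machine and constants $A,c,d\in\mathbb N$ such that for every $n \ge 0$, every graph $G$ with vertex set $\{0,\dots,n-1\}$ and every integer $h\ge 1$, the program $P$, started on $G$ (given by its adjacency matrix) and $h$ (but not given $k$), halts after at most $A\cdot 2^{c k^2}\cdot \max(n,1)^{d}$ steps with the correct answer. This holds (with a program for each) under both readings of "color class": when only the nonempty color classes, of the at most $h$ colors in use, are compared, and when the vertex set is split into exactly $h$ color classes $V_1,\dots,V_h$, some of which may be empty, and all $h$ of them are compared. The machine has registers and a memory of natural numbers, with constant assignment, copying, addition, truncated subtraction, indirect load and store, sequencing, branching and loops that test whether a register is nonzero; each elementary instruction and each test costs one step. -/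

import Mathlib

/-!
## Random access machine with unit-cost instructions

Structured programs (assignment, indirect addressing, branching, loops) over registers and a memory
of natural numbers.  The arithmetic instructions are addition and truncated subtraction only.
Every elementary instruction and every evaluation of a test takes one step.
-/

namespace RAM

/-- Programs.  The arguments `r a b` of the instructions are names of registers. -/
inductive Prog : Type
  | const (r : ℕ) (v : ℕ)      -- `r := v`
  | copy (r a : ℕ)             -- `r := a`
  | add (r a b : ℕ)            -- `r := a + b`
  | sub (r a b : ℕ)            -- `r := a - b`, truncated at `0`
  | load (r a : ℕ)             -- `r := mem[a]`
  | store (a b : ℕ)            -- `mem[a] := b`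
  | seq (p q : Prog)           -- `p; q`
  | ite (r : ℕ) (p q : Prog)   -- `if r ≠ 0 then p else q`
  | loop (r : ℕ) (p : Prog)    -- `while r ≠ 0 do p`

/-- A state: the contents of the registers and of the memory cells. -/
@[ext] structure State : Type where
  reg : ℕ → ℕ
  mem : ℕ → ℕ

/-- Overwrite register `r` by the value `v`. -/
def State.setReg (s : State) (r v : ℕ) : State :=
  { s with reg := Function.update s.reg r v }

/-- Overwrite memory cell `a` by the value `v`. -/
def State.setMem (s : State) (a v : ℕ) : State :=
  { s with mem := Function.update s.mem a v }

/-- `Exec p s t s'`: started in the state `s`, the program `p` halts after exactly `t` steps in the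
state `s'`. -/
inductive Exec : Prog → State → ℕ → State → Prop
  | const (r v : ℕ) (s : State) : Exec (.const r v) s 1 (s.setReg r v)
  | copy (r a : ℕ) (s : State) : Exec (.copy r a) s 1 (s.setReg r (s.reg a))
  | add (r a b : ℕ) (s : State) : Exec (.add r a b) s 1 (s.setReg r (s.reg a + s.reg b))
  | sub (r a b : ℕ) (s : State) : Exec (.sub r a b) s 1 (s.setReg r (s.reg a - s.reg b))
  | load (r a : ℕ) (s : State) : Exec (.load r a) s 1 (s.setReg r (s.mem (s.reg a)))
  | store (a b : ℕ) (s : State) : Exec (.store a b) s 1 (s.setMem (s.reg a) (s.reg b))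
  | seq {p q : Prog} {s s₁ s₂ : State} {t₁ t₂ : ℕ} :
      Exec p s t₁ s₁ → Exec q s₁ t₂ s₂ → Exec (.seq p q) s (t₁ + t₂) s₂
  | ite_true {r : ℕ} {p q : Prog} {s s' : State} {t : ℕ} :
      s.reg r ≠ 0 → Exec p s t s' → Exec (.ite r p q) s (t + 1) s'
  | ite_false {r : ℕ} {p q : Prog} {s s' : State} {t : ℕ} :
      s.reg r = 0 → Exec q s t s' → Exec (.ite r p q) s (t + 1) s'
  | loop_done {r : ℕ} {p : Prog} {s : State} :
      s.reg r = 0 → Exec (.loop r p) s 1 s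
  | loop_step {r : ℕ} {p : Prog} {s s₁ s₂ : State} {t₁ t₂ : ℕ} :
      s.reg r ≠ 0 → Exec p s t₁ s₁ → Exec (.loop r p) s₁ t₂ s₂ →
        Exec (.loop r p) s (t₁ + t₂ + 1) s₂

/-- The machine is deterministic. -/
theorem Exec.deterministic {p : Prog} {s s₁ s₂ : State} {t₁ t₂ : ℕ}
    (h₁ : Exec p s t₁ s₁) (h₂ : Exec p s t₂ s₂) : t₁ = t₂ ∧ s₁ = s₂ := by
  induction h₁ generalizing t₂ s₂ with
  | const | copy | add | sub | load | store => cases h₂; exact ⟨rfl, rfl⟩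
  | seq _ _ ih₁ ih₂ =>
    cases h₂ with
    | seq h h' =>
      obtain ⟨rfl, rfl⟩ := ih₁ h
      obtain ⟨rfl, rfl⟩ := ih₂ h'
      exact ⟨rfl, rfl⟩
  | ite_true hr _ ih =>
    cases h₂ with
    | ite_true _ h => obtain ⟨rfl, rfl⟩ := ih h; exact ⟨rfl, rfl⟩
    | ite_false hr' _ => exact absurd hr' hr
  | ite_false hr _ ih =>
    cases h₂ with
    | ite_true hr' _ => exact absurd hr hr'
    | ite_false _ h => obtain ⟨rfl, rfl⟩ := ih h; exact ⟨rfl, rfl⟩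
  | loop_done hr =>
    cases h₂ with
    | loop_done => exact ⟨rfl, rfl⟩
    | loop_step hr' => exact absurd hr hr'
  | loop_step hr _ _ ih₁ ih₂ =>
    cases h₂ with
    | loop_done hr' => exact absurd hr' hr
    | loop_step _ h h' =>
      obtain ⟨rfl, rfl⟩ := ih₁ h
      obtain ⟨rfl, rfl⟩ := ih₂ h'
      exact ⟨rfl, rfl⟩

open Classical in
/-- The initial state on the input `(G, h)`, where `G` is a graph with vertices `0, …, n - 1`:
register `0` holds `n`, register `1` holds `h`, the memory holds the adjacency matrix of `G` row by
row (the entry `(i, j)` is in cell `i * n + j`), and all else is `0`. -/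
noncomputable def input {n : ℕ} (G : SimpleGraph (Fin n)) (h : ℕ) : State where
  reg r := if r = 0 then n else if r = 1 then h else 0
  mem a := if ∃ i j : Fin n, G.Adj i j ∧ a = i * n + j then 1 else 0

/-- Started in the state `s`, the program `p` halts after at most `T` steps, with `1` in register `0`
if `Q` holds and with `0` in register `0` if `Q` does not hold. -/
def DecidesWithin (p : Prog) (s : State) (Q : Prop) (T : ℕ) : Prop :=
  ∃ t s', Exec p s t s' ∧ t ≤ T ∧ (Q → s'.reg 0 = 1) ∧ (¬ Q → s'.reg 0 = 0)

end RAM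

/-- There is a vertex coloring of `G` with at most `h` colors such that the sizes of any two of its
color classes differ by at most `1`; here the color classes are those of the colors in use. -/
def EquitablyColorable {V : Type*} (G : SimpleGraph V) (h : ℕ) : Prop :=
  ∃ C : G.Coloring ℕ, (Set.range C).ncard ≤ h ∧
    ∀ i ∈ Set.range C, ∀ j ∈ Set.range C, (C.colorClass i).ncard ≤ (C.colorClass j).ncard + 1

/-- There is a vertex coloring of `G` with colors from a set of `h` colors such that the sizes of any
two of the `h` color classes differ by at most `1`; here colors that are not in use count as (empty)
color classes. -/
def EquitablyColorableFin {V : Type*} (G : SimpleGraph V) (h : ℕ) : Prop :=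
  ∃ C : G.Coloring (Fin h),
    ∀ i j : Fin h, (C.colorClass i).ncard ≤ (C.colorClass j).ncard + 1

/-! Both ends of the edges of a greedily built maximal matching form a vertex cover C with |C| ≤ 2k.
Fix the number g of classes. In an equitable coloring all sizes are a or a + 1 for some a, and after
renaming the colors, those that occur on C are among the first p = min(|C| + 1, g). Suppose that a,
the colors on C, and the sizes of the first p classes are guessed. The vertices outside C are
independent, so such a vertex fits into a class as soon as it has no neighbor in the part of the
class inside C; classes with index at least p accept all of them. Distributing these vertices over
the free slots is a bipartite matching problem with as many slots as vertices.

Hall's condition needs to be tested for few sets only. The slots of one class have the same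
candidates, and a single slot of a class with index at least p already has all vertices outside C as
candidates. So the 2^p sets J of classes below p suffice. This is `IsPlan`; `IsPlan.colorable` and
`EquitablyColorableFin.exists_isPlan` are the two directions.

The guesses and J are encoded by numbers a ≤ n, X < p^|C|, and Y, Z < 2^p, so exhaustive search is
polynomial in n + 2^((|C|+1)^2), hence in 2^O(k^2) n. To turn this into a program with a time bound,
`Ctx.Comp` collects the functions computable in polynomial time without writing to memory. It is
closed under arithmetic, bounded sums and bounded quantifiers (with side conditions on sizes), so
the criterion is computable by its form (`compP_accept`, `compP_acceptFin`). Only the search for the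
cover writes to memory (`exists_cover`). The two readings of "color class" differ in which g are
admitted: some g ≤ h, or g = h. -/

/-! ### Running time rules for programs and loops -/

namespace RAM

/-- `Runs p s T Q`: started in `s`, the program `p` halts after at most `T` steps in a state with
the property `Q`. -/
def Runs (p : Prog) (s : State) (T : ℕ) (Q : State → Prop) : Prop :=
  ∃ t s', Exec p s t s' ∧ t ≤ T ∧ Q s'

namespace Runs

variable {p q : Prog} {s : State} {T T' : ℕ} {Q Q' : State → Prop}

theorem mono (h : Runs p s T Q) (hT : T ≤ T') (hQ : ∀ s', Q s' → Q' s') : Runs p s T' Q' := by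
  obtain ⟨t, s', he, ht, hq⟩ := h
  exact ⟨t, s', he, ht.trans hT, hQ _ hq⟩

theorem const {r v : ℕ} (h : Q (s.setReg r v)) : Runs (.const r v) s 1 Q :=
  ⟨1, _, .const r v s, le_rfl, h⟩

theorem copy {r a : ℕ} (h : Q (s.setReg r (s.reg a))) : Runs (.copy r a) s 1 Q :=
  ⟨1, _, .copy r a s, le_rfl, h⟩

theorem add {r a b : ℕ} (h : Q (s.setReg r (s.reg a + s.reg b))) : Runs (.add r a b) s 1 Q :=
  ⟨1, _, .add r a b s, le_rfl, h⟩

theorem sub {r a b : ℕ} (h : Q (s.setReg r (s.reg a - s.reg b))) : Runs (.sub r a b) s 1 Q :=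
  ⟨1, _, .sub r a b s, le_rfl, h⟩

theorem load {r a : ℕ} (h : Q (s.setReg r (s.mem (s.reg a)))) : Runs (.load r a) s 1 Q :=
  ⟨1, _, .load r a s, le_rfl, h⟩

theorem store {a b : ℕ} (h : Q (s.setMem (s.reg a) (s.reg b))) : Runs (.store a b) s 1 Q :=
  ⟨1, _, .store a b s, le_rfl, h⟩

theorem seq (h : Runs p s T Q) (h' : ∀ s', Q s' → Runs q s' T' Q') :
    Runs (.seq p q) s (T + T') Q' := by
  obtain ⟨t, s', he, ht, hq⟩ := h
  obtain ⟨t', s'', he', ht', hq'⟩ := h' s' hq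
  exact ⟨t + t', s'', he.seq he', add_le_add ht ht', hq'⟩

theorem ite {r : ℕ} (h : s.reg r ≠ 0 → Runs p s T Q) (h' : s.reg r = 0 → Runs q s T Q) :
    Runs (.ite r p q) s (T + 1) Q := by
  by_cases hr : s.reg r = 0
  · obtain ⟨t, s', he, ht, hq⟩ := h' hr
    exact ⟨t + 1, s', .ite_false hr he, by omega, hq⟩
  · obtain ⟨t, s', he, ht, hq⟩ := h hr
    exact ⟨t + 1, s', .ite_true hr he, by omega, hq⟩

/-- The index of the invariant is the number of rounds that remain, so the invariant also yields
termination. -/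
theorem loop {r : ℕ} {I : ℕ → State → Prop} (h0 : ∀ s, I 0 s → s.reg r = 0)
    (hs : ∀ k s, I (k + 1) s → s.reg r ≠ 0 ∧ Runs p s T (I k)) {k : ℕ} (h : I k s) :
    Runs (.loop r p) s (k * (T + 1) + 1) (I 0) := by
  induction k generalizing s with
  | zero => exact ⟨1, s, .loop_done (h0 _ h), by omega, h⟩
  | succ k ih =>
    obtain ⟨hr, t, s', he, ht, hq⟩ := hs k s h
    obtain ⟨t', s'', he', ht', hq'⟩ := ih hq
    exact ⟨t + t' + 1, s'', .loop_step hr he he', by rw [add_mul]; omega, hq'⟩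

end Runs

/-- Run `p` with register `d` counting from `0` upwards, as often as register `d + 1` says. -/
def forLoop (d : ℕ) (p : Prog) : Prog :=
  .seq (.const d 0) (.loop (d + 1) (.seq p (.seq (.const (d + 2) 1)
    (.seq (.add d d (d + 2)) (.sub (d + 1) (d + 1) (d + 2))))))

/-- Register `d` is the counter, `d + 1` holds the rounds left, and `d + 2` is overwritten by the
constant 1 in each round. So the invariant may depend only on the memory and the registers below
`d`, which is `hI`. -/
theorem Runs.forLoop {d : ℕ} {p : Prog} {s : State} {T b : ℕ} {I : ℕ → State → Prop}
    (hI : ∀ i s s', I i s → (∀ r < d, s'.reg r = s.reg r) → s'.mem = s.mem → I i s')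
    (hp : ∀ i < b, ∀ s, I i s → s.reg d = i →
      Runs p s T (fun s' => I (i + 1) s' ∧ s'.reg d = i ∧ s'.reg (d + 1) = s.reg (d + 1)))
    (hb : s.reg (d + 1) = b) (h : I 0 s) :
    Runs (forLoop d p) s (b * (T + 4) + 2) (I b) := by
  have key := Runs.loop (r := d + 1) (p := .seq p (.seq (.const (d + 2) 1)
    (.seq (.add d d (d + 2)) (.sub (d + 1) (d + 1) (d + 2))))) (T := T + 3)
    (I := fun k s => k ≤ b ∧ I (b - k) s ∧ s.reg d = b - k ∧ s.reg (d + 1) = k)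
    (fun s h => h.2.2.2) ?_ (k := b) (s := s.setReg d 0) ?_
  · refine ((Runs.const (Q := fun s' => s' = s.setReg d 0) rfl).seq
      (fun s' hs' => hs' ▸ key)).mono (by rw [add_assoc T 3 1]; omega) (fun s' h => h.2.1)
  · rintro k s ⟨hk, hIk, hd, hd1⟩
    refine ⟨by omega, ?_⟩
    refine (hp (b - (k + 1)) (by omega) s hIk hd).seq (T' := 3) ?_
    rintro s' ⟨h1, h2, h3⟩
    refine (Runs.const (Q := fun s'' => s'' = s'.setReg (d + 2) 1) rfl).seq (T' := 2) ?_
    rintro _ rfl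
    refine (Runs.add rfl : Runs _ _ _ (fun s'' => s'' = _)).seq (T' := 1) ?_
    rintro _ rfl
    refine Runs.sub ⟨by omega, ?_, ?_, ?_⟩
    · have : b - (k + 1) + 1 = b - k := by omega
      rw [this] at h1
      refine hI _ _ _ h1 (fun r hr => ?_) rfl
      simp [State.setReg, Function.update, show r ≠ d by omega, show r ≠ d + 1 by omega,
        show r ≠ d + 2 by omega]
    · simp [State.setReg, Function.update, h2]; omega
    · simp [State.setReg, Function.update, h3, hd1]
  · refine ⟨le_rfl, ?_, ?_, ?_⟩
    · rw [Nat.sub_self]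
      refine hI _ _ _ h (fun r hr => ?_) rfl
      simp [State.setReg, Function.update, show r ≠ d by omega]
    · simp [State.setReg]
    · simp [State.setReg, Function.update, hb]

/-! ### Functions and predicates computable in polynomial time -/

/-- What a program knows about its parameter `γ : Γ`: some numbers `var 0 γ, …, var (len - 1) γ`, to
be found in registers, and the memory `mem γ`.  The property `ok γ` may be taken for granted, and
running times are measured in terms of `bound γ`. -/
structure Ctx (Γ : Type) : Type where
  len : ℕ
  var : ℕ → Γ → ℕ
  mem : Γ → ℕ → ℕ
  bound : Γ → ℕ
  ok : Γ → Prop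

variable {Γ : Type}

/-- Extension of a context by one more number. -/
def Ctx.ext (c : Ctx Γ) (Q : Γ → ℕ → Prop) : Ctx (Γ × ℕ) where
  len := c.len + 1
  var r x := if r < c.len then c.var r x.1 else x.2
  mem x := c.mem x.1
  bound x := c.bound x.1
  ok x := c.ok x.1 ∧ Q x.1 x.2

/-- The state `s` represents `γ`, the variables being in the registers given by `pos`. -/
def Ctx.Rep (c : Ctx Γ) (pos : ℕ → ℕ) (γ : Γ) (s : State) : Prop :=
  c.ok γ ∧ (∀ r < c.len, s.reg (pos r) = c.var r γ) ∧ s.mem = c.mem γ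

/-- `T` is bounded by a polynomial in the bound of the context. -/
def Ctx.Poly (c : Ctx Γ) (T : Γ → ℕ) : Prop :=
  ∃ A e, ∀ γ, c.ok γ → T γ ≤ A * (c.bound γ + 1) ^ e

/-- `s'` differs from `s` at most in the registers from `d` on. -/
def SameBelow (d : ℕ) (s s' : State) : Prop :=
  (∀ r < d, s'.reg r = s.reg r) ∧ s'.mem = s.mem

/-- The function `g` is computed in polynomial time by programs that leave the memory alone: for all
register assignments and all `d` there is one that writes the value to register `d` and uses
only the registers from `d` on. -/
def Ctx.Comp (c : Ctx Γ) (g : Γ → ℕ) : Prop :=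
  ∀ (pos : ℕ → ℕ) (d : ℕ), (∀ r < c.len, pos r < d) → ∃ p T, c.Poly T ∧ ∀ γ s, c.Rep pos γ s →
    Runs p s (T γ) (fun s' => s'.reg d = g γ ∧ SameBelow d s s')

open Classical in
/-- The predicate `P` is decided in polynomial time. -/
def Ctx.CompP (c : Ctx Γ) (P : Γ → Prop) : Prop :=
  c.Comp (fun γ => if P γ then 1 else 0)

theorem SameBelow.trans {d : ℕ} {s s' s'' : State} (h : SameBelow d s s')
    (h' : SameBelow d s' s'') : SameBelow d s s'' :=
  ⟨fun r hr => (h'.1 r hr).trans (h.1 r hr), h'.2.trans h.2⟩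

theorem SameBelow.mono {d d' : ℕ} {s s' : State} (h : SameBelow d s s') (hd : d' ≤ d) :
    SameBelow d' s s' :=
  ⟨fun r hr => h.1 r (hr.trans_le hd), h.2⟩

theorem sameBelow_setReg {d r v : ℕ} {s : State} (h : d ≤ r) : SameBelow d s (s.setReg r v) :=
  ⟨fun r' hr' => by simp [State.setReg, Function.update, show r' ≠ r by omega], rfl⟩

@[simp] theorem State.reg_setReg_self (s : State) (r v : ℕ) : (s.setReg r v).reg r = v := by
  simp [State.setReg]

namespace Ctx

variable {c : Ctx Γ} {pos : ℕ → ℕ} {γ : Γ} {s s' : State} {d : ℕ}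

theorem Rep.of_sameBelow (h : c.Rep pos γ s) (hpos : ∀ r < c.len, pos r < d)
    (hs : SameBelow d s s') : c.Rep pos γ s' :=
  ⟨h.1, fun r hr => (hs.1 _ (hpos r hr)).trans (h.2.1 r hr), hs.2.trans h.2.2⟩

theorem Rep.ext (h : c.Rep pos γ s) {Q : Γ → ℕ → Prop} {x r : ℕ} (hx : s.reg r = x)
    (hQ : Q γ x) : (c.ext Q).Rep (fun i => if i < c.len then pos i else r) (γ, x) s := by
  refine ⟨⟨h.1, hQ⟩, fun i hi => ?_, h.2.2⟩
  by_cases hi' : i < c.len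
  · simp [Ctx.ext, hi', h.2.1]
  · simp [Ctx.ext, hi', hx]

theorem ext_pos {Q : Γ → ℕ → Prop} {r : ℕ} (hpos : ∀ i < c.len, pos i < d) (hr : r < d) :
    ∀ i < (c.ext Q).len, (if i < c.len then pos i else r) < d := by
  intro i _
  split_ifs with h
  exacts [hpos i h, hr]

namespace Poly

variable {T T' : Γ → ℕ}

theorem const (k : ℕ) : c.Poly (fun _ => k) := ⟨k, 0, by simp⟩

theorem bound : c.Poly c.bound := ⟨1, 1, by simp⟩

theorem add (h : c.Poly T) (h' : c.Poly T') : c.Poly (fun γ => T γ + T' γ) := by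
  obtain ⟨A, e, h⟩ := h
  obtain ⟨A', e', h'⟩ := h'
  refine ⟨A + A', e + e', fun γ hγ => ?_⟩
  rw [add_mul]
  exact add_le_add
    ((h γ hγ).trans (Nat.mul_le_mul_left _ (Nat.pow_le_pow_right (by omega) (by omega))))
    ((h' γ hγ).trans (Nat.mul_le_mul_left _ (Nat.pow_le_pow_right (by omega) (by omega))))

theorem mul (h : c.Poly T) (h' : c.Poly T') : c.Poly (fun γ => T γ * T' γ) := by
  obtain ⟨A, e, h⟩ := h
  obtain ⟨A', e', h'⟩ := h'
  refine ⟨A * A', e + e', fun γ hγ => (Nat.mul_le_mul (h γ hγ) (h' γ hγ)).trans (le_of_eq ?_)⟩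
  ring

theorem pow_bound (A e : ℕ) : c.Poly (fun γ => A * (c.bound γ + 1) ^ e) := ⟨A, e, by simp⟩

end Poly

namespace Comp

variable {f g : Γ → ℕ}

theorem congr (h : c.Comp f) (hfg : ∀ γ, c.ok γ → f γ = g γ) : c.Comp g := by
  intro pos d hpos
  obtain ⟨p, T, hT, h⟩ := h pos d hpos
  exact ⟨p, T, hT, fun γ s hs => (h γ s hs).mono le_rfl
    (fun s' hs' => ⟨hs'.1.trans (hfg γ hs.1), hs'.2⟩)⟩

theorem const (k : ℕ) : c.Comp (fun _ => k) := fun _ d _ =>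
  ⟨.const d k, fun _ => 1, .const 1, fun _ s _ => .const ⟨by simp, sameBelow_setReg le_rfl⟩⟩

theorem var {r : ℕ} (hr : r < c.len) : c.Comp (c.var r) := fun pos d _ =>
  ⟨.copy d (pos r), fun _ => 1, .const 1, fun _ s hs =>
    .copy ⟨by simp [hs.2.1 r hr], sameBelow_setReg le_rfl⟩⟩

theorem last {Q : Γ → ℕ → Prop} : (c.ext Q).Comp (fun x => x.2) :=
  (var (c := c.ext Q) (r := c.len) (Nat.lt_succ_self _)).congr (by simp [Ctx.ext])

theorem weaken (h : c.Comp g) {Q : Γ → ℕ → Prop} : (c.ext Q).Comp (fun x => g x.1) := by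
  intro pos d hpos
  obtain ⟨p, T, ⟨A, e, hT⟩, h⟩ := h pos d (fun r hr => hpos r (Nat.lt_succ_of_lt hr))
  refine ⟨p, fun x => T x.1, ⟨A, e, fun x hx => hT _ hx.1⟩, fun x s hs => h x.1 s ⟨hs.1.1, ?_, hs.2.2⟩⟩
  intro r hr
  rw [hs.2.1 r (Nat.lt_succ_of_lt hr)]
  simp [Ctx.ext, hr]

/-- The first operand rests in `d` while the second is computed from `d + 1` on. This is the use of
the arbitrary `d` in `Ctx.Comp`. -/
theorem binary {op : ℕ → ℕ → ℕ} {instr : ℕ → Prog}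
    (hop : ∀ d s, ∃ t ≤ 1, Exec (instr d) s t (s.setReg d (op (s.reg d) (s.reg (d + 1)))))
    (hf : c.Comp f) (hg : c.Comp g) : c.Comp (fun γ => op (f γ) (g γ)) := by
  intro pos d hpos
  obtain ⟨p, T, hT, h⟩ := hf pos d hpos
  obtain ⟨p', T', hT', h'⟩ := hg pos (d + 1) (fun i hi => (hpos i hi).trans d.lt_succ_self)
  refine ⟨.seq p (.seq p' (instr d)), fun γ => T γ + (T' γ + 1), hT.add (hT'.add (.const 1)),
    fun γ s hs => (h γ s hs).seq fun s₁ ⟨h1, h2⟩ =>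
      (h' γ s₁ (hs.of_sameBelow hpos h2)).seq fun s₂ ⟨h3, h4⟩ => ?_⟩
  obtain ⟨t, ht, he⟩ := hop d s₂
  refine ⟨t, _, he, ht, ?_, h2.trans ((h4.mono (Nat.le_succ d)).trans (sameBelow_setReg le_rfl))⟩
  simp [h3, h4.1 d d.lt_succ_self, h1]

theorem add (hf : c.Comp f) (hg : c.Comp g) : c.Comp (fun γ => f γ + g γ) :=
  binary (instr := fun d => .add d d (d + 1)) (fun _ _ => ⟨1, le_rfl, .add ..⟩) hf hg

theorem sub (hf : c.Comp f) (hg : c.Comp g) : c.Comp (fun γ => f γ - g γ) :=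
  binary (instr := fun d => .sub d d (d + 1)) (fun _ _ => ⟨1, le_rfl, .sub ..⟩) hf hg

theorem load (hf : c.Comp f) : c.Comp (fun γ => c.mem γ (f γ)) := by
  intro pos d hpos
  obtain ⟨p, T, hT, h⟩ := hf pos d hpos
  refine ⟨.seq p (.load d d), fun γ => T γ + 1, hT.add (.const 1),
    fun γ s hs => (h γ s hs).seq fun s₁ ⟨h1, h2⟩ => ?_⟩
  exact .load ⟨by simp [h1, h2.2, hs.2.2], h2.trans (sameBelow_setReg le_rfl)⟩

/-- Primitive recursion. -/
theorem fold {b : Γ → ℕ} {F : Γ → ℕ → ℕ → ℕ} (hb : c.Comp b)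
    (hle : ∀ γ, c.ok γ → b γ ≤ c.bound γ) (hf : c.Comp f)
    (hF : ((c.ext fun γ i => i < b γ).ext fun _ _ => True).Comp
      (fun x => F x.1.1 x.1.2 x.2)) :
    c.Comp (fun γ => Nat.rec (f γ) (fun i acc => F γ i acc) (b γ)) := by
  intro pos d hpos
  obtain ⟨p, T, hT, h⟩ := hf pos d hpos
  obtain ⟨p₁, T₁, hT₁, h₁⟩ := hb pos (d + 2) (fun i hi => (hpos i hi).trans (by omega))
  obtain ⟨p₂, T₂, ⟨A, e, hT₂⟩, h₂⟩ := hF _ (d + 3)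
    (ext_pos (r := d) (ext_pos (c := c) (pos := pos) (r := d + 1)
      (fun i hi => (hpos i hi).trans (by omega)) (by omega)) (by omega))
  -- The accumulator is in `d`, the counter in `d + 1`, the rounds left in `d + 2`. The body
  -- delivers its value in `d + 3`, which the loop may overwrite once the value is copied.
  refine ⟨.seq p (.seq p₁ (forLoop (d + 1) (.seq p₂ (.copy d (d + 3))))),
    fun γ => T γ + (T₁ γ + (c.bound γ * ((A * (c.bound γ + 1) ^ e + 1) + 4) + 2)),
    hT.add (hT₁.add ((Poly.bound.mul (((Poly.pow_bound A e).add (.const 1)).add (.const 4))).add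
      (.const 2))),
    fun γ s hs => (h γ s hs).seq fun s₁ ⟨h1, h2⟩ =>
      (h₁ γ s₁ (hs.of_sameBelow hpos h2)).seq fun s₂ ⟨h3, h4⟩ => ?_⟩
  refine (Runs.forLoop (T := A * (c.bound γ + 1) ^ e + 1) (I := fun i s' =>
    s'.reg d = Nat.rec (f γ) (fun i acc => F γ i acc) i ∧ SameBelow d s s') ?_ ?_ h3 ?_).mono
    ?_ (fun _ => id)
  · rintro i s' s'' ⟨hr, hsb⟩ hr' hm
    exact ⟨(hr' d d.lt_succ_self).trans hr,
      hsb.trans ⟨fun r hr => hr' r (hr.trans d.lt_succ_self), hm⟩⟩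
  · rintro i hi s' ⟨hr, hsb⟩ hi'
    have hok := ((hs.of_sameBelow hpos hsb).ext (Q := fun γ i => i < b γ) hi' hi).ext
      (Q := fun _ _ => True) hr trivial
    refine ((h₂ _ s' hok).mono (hT₂ _ hok.1) (fun _ => id)).seq fun s'' ⟨h5, h6⟩ => .copy ?_
    refine ⟨⟨by simp [h5], hsb.trans ((h6.mono (by omega)).trans (sameBelow_setReg le_rfl))⟩,
      ?_, ?_⟩
    · simp [State.setReg, h6.1 (d + 1) (by omega), hi']
    · simpa [State.setReg, Function.update, show d + 1 + 1 ≠ d by omega] using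
        h6.1 (d + 1 + 1) (by omega)
  · exact ⟨(h4.1 d (by omega)).trans h1, h2.trans (h4.mono (by omega))⟩
  · exact Nat.add_le_add_right (Nat.mul_le_mul_right _ (hle γ hs.1)) _

theorem ite {P : Γ → Prop} [DecidablePred P] (hP : c.CompP P) (hf : c.Comp f) (hg : c.Comp g) :
    c.Comp (fun γ => if P γ then f γ else g γ) := by
  intro pos d hpos
  obtain ⟨p, T, hT, h⟩ := hP pos d hpos
  obtain ⟨p₁, T₁, hT₁, h₁⟩ := hf pos d hpos
  obtain ⟨p₂, T₂, hT₂, h₂⟩ := hg pos d hpos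
  refine ⟨.seq p (.ite d p₁ p₂), fun γ => T γ + (T₁ γ + T₂ γ + 1),
    hT.add ((hT₁.add hT₂).add (.const 1)), fun γ s hs => (h γ s hs).seq fun s₁ ⟨h1, h2⟩ => ?_⟩
  refine .ite (fun hr => ?_) (fun hr => ?_)
  · have : P γ := by by_contra hP; simp [hP] at h1; exact hr h1
    exact (h₁ γ s₁ (hs.of_sameBelow hpos h2)).mono (Nat.le_add_right _ _)
      fun s' h' => ⟨by simp [h'.1, this], h2.trans h'.2⟩
  · have : ¬ P γ := by intro hP; simp [hP] at h1; omega
    exact (h₂ γ s₁ (hs.of_sameBelow hpos h2)).mono (Nat.le_add_left _ _)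
      fun s' h' => ⟨by simp [h'.1, this], h2.trans h'.2⟩

theorem sum {b : Γ → ℕ} {F : Γ → ℕ → ℕ} (hb : c.Comp b) (hle : ∀ γ, c.ok γ → b γ ≤ c.bound γ)
    (hF : (c.ext fun γ i => i < b γ).Comp (fun x => F x.1 x.2)) :
    c.Comp (fun γ => ∑ i ∈ Finset.range (b γ), F γ i) := by
  refine (fold (F := fun γ i acc => acc + F γ i) hb hle (const 0) (last.add hF.weaken)).congr ?_
  intro γ _
  induction b γ with
  | zero => simp
  | succ k ih => exact (congrArg (· + F γ k) ih).trans (Finset.sum_range_succ _ _).symm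

/-- Repeated addition: only the first factor counts the rounds, so the second may be arbitrarily
large. -/
theorem mul (hf : c.Comp f) (hle : ∀ γ, c.ok γ → f γ ≤ c.bound γ) (hg : c.Comp g) :
    c.Comp (fun γ => f γ * g γ) :=
  (sum (F := fun γ _ => g γ) hf hle hg.weaken).congr
    (fun γ _ => by rw [Finset.sum_const, Finset.card_range, smul_eq_mul])

/-- The accumulator is always the second factor of a product, so its growth does not affect the
time. -/
theorem pow (hf : c.Comp f) (hle : ∀ γ, c.ok γ → f γ ≤ c.bound γ) (hg : c.Comp g)
    (hle' : ∀ γ, c.ok γ → g γ ≤ c.bound γ) : c.Comp (fun γ => f γ ^ g γ) := by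
  refine (fold (F := fun γ i acc => f γ * acc) hg hle' (const 1)
    (hf.weaken.weaken.mul (fun x hx => hle _ hx.1.1) last)).congr ?_
  intro γ _
  induction g γ with
  | zero => simp
  | succ k ih => rw [pow_succ', ← ih]

end Comp

namespace CompP

variable {P P' : Γ → Prop} {f g : Γ → ℕ}

theorem congr (h : c.CompP P) (hP : ∀ γ, c.ok γ → (P γ ↔ P' γ)) : c.CompP P' := by
  classical
  exact Comp.congr h (fun γ hγ => if_congr (hP γ hγ) rfl rfl)

theorem indicator [DecidablePred P] (h : c.CompP P) : c.Comp (fun γ => if P γ then 1 else 0) :=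
  Comp.congr h (fun γ _ => by split_ifs <;> rfl)

theorem not (h : c.CompP P) : c.CompP (fun γ => ¬ P γ) :=
  ((Comp.const 1).sub h).congr (fun γ _ => by by_cases h : P γ <;> simp [h])

theorem and (h : c.CompP P) (h' : c.CompP P') : c.CompP (fun γ => P γ ∧ P' γ) := by
  classical
  exact (Comp.ite h h' (.const 0)).congr (fun γ _ => by by_cases h : P γ <;> simp [h])

theorem or (h : c.CompP P) (h' : c.CompP P') : c.CompP (fun γ => P γ ∨ P' γ) :=
  (h.not.and h'.not).not.congr (fun γ _ => by tauto)

theorem imp (h : c.CompP P) (h' : c.CompP P') : c.CompP (fun γ => P γ → P' γ) :=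
  (h.not.or h').congr (fun γ _ => by tauto)

theorem eq_zero (h : c.Comp f) : c.CompP (fun γ => f γ = 0) :=
  ((Comp.const 1).sub h).congr (fun γ _ => by split_ifs with h <;> omega)

theorem le (hf : c.Comp f) (hg : c.Comp g) : c.CompP (fun γ => f γ ≤ g γ) :=
  (eq_zero (hf.sub hg)).congr (fun γ _ => by omega)

theorem eq (hf : c.Comp f) (hg : c.Comp g) : c.CompP (fun γ => f γ = g γ) :=
  ((le hf hg).and (le hg hf)).congr (fun γ _ => by omega)

/-- The sum counts the counterexamples; the predicate holds throughout when it is 0. -/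
theorem all {b : Γ → ℕ} {P : Γ → ℕ → Prop} (hb : c.Comp b)
    (hle : ∀ γ, c.ok γ → b γ ≤ c.bound γ)
    (hP : (c.ext fun γ i => i < b γ).CompP (fun x => P x.1 x.2)) :
    c.CompP (fun γ => ∀ i < b γ, P γ i) := by
  classical
  exact (eq_zero (Comp.sum (F := fun γ i => if ¬ P γ i then 1 else 0) hb hle
    hP.not.indicator)).congr (fun γ _ => by simp)

theorem ex {b : Γ → ℕ} {P : Γ → ℕ → Prop} (hb : c.Comp b)
    (hle : ∀ γ, c.ok γ → b γ ≤ c.bound γ)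
    (hP : (c.ext fun γ i => i < b γ).CompP (fun x => P x.1 x.2)) :
    c.CompP (fun γ => ∃ i < b γ, P γ i) :=
  (all (P := fun γ i => ¬ P γ i) hb hle hP.not).not.congr (fun γ _ => by simp)

end CompP

namespace Comp

variable {f g : Γ → ℕ}

open Classical in
theorem count {b : Γ → ℕ} {P : Γ → ℕ → Prop} (hb : c.Comp b)
    (hle : ∀ γ, c.ok γ → b γ ≤ c.bound γ)
    (hP : (c.ext fun γ i => i < b γ).CompP (fun x => P x.1 x.2)) :
    c.Comp (fun γ => Nat.count (P γ) (b γ)) :=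
  (Comp.sum (F := fun γ i => if P γ i then 1 else 0) hb hle
    hP.indicator).congr (fun γ _ => by
      rw [Nat.count_eq_card_filter_range, Finset.card_filter])

theorem min (hf : c.Comp f) (hg : c.Comp g) : c.Comp (fun γ => Min.min (f γ) (g γ)) :=
  (hf.sub (hf.sub hg)).congr (fun γ _ => by omega)

/-- The quotient is the number of `j` with `(j + 1) * g γ ≤ f γ`, and all of these are below `f γ`.
-/
theorem div (hf : c.Comp f) (hle : ∀ γ, c.ok γ → f γ ≤ c.bound γ) (hg : c.Comp g)
    (hpos : ∀ γ, c.ok γ → 0 < g γ) : c.Comp (fun γ => f γ / g γ) := by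
  classical
  refine (count (P := fun γ j => (j + 1) * g γ ≤ f γ) hf hle (.le (.mul (last.add (.const 1))
    (fun x hx => (Nat.succ_le_of_lt hx.2).trans (hle _ hx.1)) hg.weaken) hf.weaken)).congr (fun γ hγ => ?_)
  have : ∀ j, (j + 1) * g γ ≤ f γ ↔ j < f γ / g γ := fun j =>
    (Nat.le_div_iff_mul_le (hpos γ hγ)).symm
  simp only [this]
  rw [Nat.count_eq_card_filter_range, ← Finset.card_range (f γ / g γ)]
  congr 1
  ext j
  simpa using fun h => h.trans_le (Nat.div_le_self _ _)

theorem mod (hf : c.Comp f) (hle : ∀ γ, c.ok γ → f γ ≤ c.bound γ) (hg : c.Comp g)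
    (hpos : ∀ γ, c.ok γ → 0 < g γ) (hle' : ∀ γ, c.ok γ → g γ ≤ c.bound γ) :
    c.Comp (fun γ => f γ % g γ) :=
  (hf.sub (hg.mul hle' (hf.div hle hg hpos))).congr (fun γ _ => by rw [Nat.mod_eq_sub])

end Comp

end Ctx

end RAM

/-! ### Equitable colorings and Hall's condition -/

open Finset in
open Classical in
/-- A plan for a coloring with `g` classes of sizes `a` and `a + 1`: the color `f v < p` of each
vertex `v` of the vertex cover `C`, and the sizes `a + y j` of the classes with index `j < p`.  The
last condition is Hall's condition for filling up these classes with vertices outside `C`. -/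
structure IsPlan {V : Type*} [Fintype V] (G : SimpleGraph V) (C : Finset V) (g p a : ℕ) (f : V → ℕ)
    (y : ℕ → ℕ) : Prop where
  lt : ∀ v ∈ C, f v < p
  le_one : ∀ j < p, y j ≤ 1
  le_card : g * a + ∑ j ∈ range p, y j ≤ Fintype.card V
  card_le : Fintype.card V ≤ g * a + ∑ j ∈ range p, y j + (g - p)
  proper : ∀ u ∈ C, ∀ v ∈ C, G.Adj u v → f u ≠ f v
  fits : ∀ j < p, #{v ∈ C | f v = j} ≤ a + y j
  hall : ∀ J ⊆ range p, ∑ j ∈ J, (a + y j - #{v ∈ C | f v = j}) ≤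
    #{v | v ∉ C ∧ ∃ j ∈ J, ∀ u ∈ C, f u = j → ¬ G.Adj v u}

section

open Finset

variable {V : Type*} {G : SimpleGraph V} {C : Finset V} {g p a : ℕ} {f : V → ℕ} {y : ℕ → ℕ}

/-- At most `min g #C` colors occur on `C`. They are enlarged to a set of exactly `p` colors, which
a permutation of all colors moves to the first `p`. -/
theorem EquitablyColorableFin.exists_coloring_lt (h : EquitablyColorableFin G g) (hp : p ≤ g)
    (hCp : min g #C ≤ p) : ∃ c : G.Coloring (Fin g), (∀ v ∈ C, (c v : ℕ) < p) ∧
      ∀ i j : Fin g, (c.colorClass i).ncard ≤ (c.colorClass j).ncard + 1 := by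
  classical
  obtain ⟨c, hc⟩ := h
  have h1 : #(C.image c) ≤ p := by
    have h1 := card_image_le (s := C) (f := c)
    have h2 := card_le_univ (C.image c)
    rw [Fintype.card_fin] at h2
    omega
  obtain ⟨D, hD, hDc⟩ := exists_superset_card_eq h1 (by simpa using hp)
  obtain ⟨σ, hσ⟩ := Equiv.Perm.exists_map_finset_eq D ({j | (j : ℕ) < p} : Finset (Fin g))
    (by rw [hDc, Fin.card_filter_val_lt]; omega)
  let c' : G.Coloring (Fin g) := .mk (fun v => σ (c v)) fun {v w} hvw h =>
    c.valid hvw (σ.injective h)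
  have hc' : ∀ j, c'.colorClass j = c.colorClass (σ.symm j) := by
    intro j
    ext v
    change σ (c v) = j ↔ c v = σ.symm j
    rw [Equiv.eq_symm_apply]
  refine ⟨c', fun v hv => ?_, fun i j => by rw [hc', hc']; exact hc _ _⟩
  have : σ (c v) ∈ D.map σ.toEmbedding := mem_map_of_mem _ (hD (mem_image_of_mem _ hv))
  rw [hσ] at this
  exact (mem_filter.1 this).2

variable [Fintype V]

theorem IsPlan.exists_size (h : IsPlan G C g p a f y) (hp : p ≤ g) :
    ∃ size : ℕ → ℕ, (∀ j < p, size j = a + y j) ∧ (∀ j, j < g → a ≤ size j ∧ size j ≤ a + 1) ∧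
      ∑ j ∈ range g, size j = Fintype.card V := by
  obtain ⟨b, hb⟩ := Nat.exists_eq_add_of_le h.le_card
  have hbg : p + b ≤ g := by have := h.card_le; omega
  obtain ⟨r, rfl⟩ := Nat.exists_eq_add_of_le hbg
  -- Here `b` is the number of vertices exceeding `g * a` that the first `p` classes do not absorb;
  -- the next `b` classes take one each.
  refine ⟨fun j => a + if j < p then y j else if j < p + b then 1 else 0, fun j hj => by simp [hj],
    fun j hj => ⟨Nat.le_add_right _ _, ?_⟩, ?_⟩
  · have := h.le_one j
    dsimp only
    split_ifs <;> grind
  · rw [Finset.sum_add_distrib, sum_const, sum_range_add, sum_range_add, hb]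
    have h1 : ∑ x ∈ range p, (if x < p then y x else if x < p + b then 1 else 0) =
        ∑ x ∈ range p, y x := sum_congr rfl fun x hx => by simp [mem_range.1 hx]
    have h2 : ∑ x ∈ range b, (if p + x < p then y (p + x) else if p + x < p + b then 1 else 0) =
        ∑ x ∈ range b, 1 := sum_congr rfl fun x hx => by simp [mem_range.1 hx]
    have h3 : ∑ x ∈ range r, (if p + b + x < p then y (p + b + x) else
        if p + b + x < p + b then 1 else 0) = ∑ x ∈ range r, 0 :=
      sum_congr rfl fun x hx => by
        rw [if_neg (by omega), if_neg (by omega)]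
    rw [h1, h2, h3]
    simp
    ring

/-- A Hall matching assigns distinct vertices outside `C` to the free slots. Slots and vertices are
equal in number, so every vertex is placed and every class attains its size. -/
theorem IsPlan.colorable (h : IsPlan G C g p a f y) (hp : p ≤ g) (hC : G.IsVertexCover C) :
    EquitablyColorableFin G g := by
  classical
  obtain ⟨size, hs1, hs2, hs3⟩ := h.exists_size hp
  set S : ℕ → ℕ := fun j => #{v ∈ C | f v = j} with hS
  have hSsize : ∀ j < g, S j ≤ size j := by
    intro j hj
    by_cases hjp : j < p
    · rw [hs1 j hjp]; exact h.fits j hjp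
    · have : S j = 0 := by
        rw [hS, card_eq_zero, filter_eq_empty_iff]
        rintro v hv rfl
        exact hjp (h.lt v hv)
      omega
  have hSsum : ∑ j ∈ range g, S j = #C :=
    (card_eq_sum_card_fiberwise fun v hv => by simpa using (h.lt v hv).trans_le hp).symm
  -- One slot for each vertex that class `j` still lacks; `t` gives the candidates for a slot.
  let ι := Σ j : Fin g, Fin (size j - S j)
  let t : ι → Finset V := fun x => {v | v ∉ C ∧ ∀ u ∈ C, f u = x.1 → ¬ G.Adj v u}
  have hι : Fintype.card ι = #(univ \ C) := by
    rw [card_sdiff_of_subset (subset_univ _), Fintype.card_sigma]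
    simp only [Fintype.card_fin]
    rw [Fin.sum_univ_eq_sum_range (fun j => size j - S j), sum_tsub_distrib _
      (fun j hj => hSsize j (mem_range.1 hj)), hs3, hSsum, card_univ]
  have hall : ∀ s : Finset ι, #s ≤ #(s.biUnion t) := by
    intro s
    -- A slot of a class with index at least `p` has every vertex outside `C` as a candidate, since
    -- no vertex of `C` has that color. Their number is the number of all slots.
    by_cases hs : ∃ x ∈ s, p ≤ x.1
    · obtain ⟨x, hx, hpx⟩ := hs
      refine (card_le_univ s).trans (hι.le.trans (card_le_card fun v hv => ?_))
      rw [mem_biUnion]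
      refine ⟨x, hx, ?_⟩
      simp only [mem_sdiff, mem_univ, true_and] at hv
      simp only [t, mem_filter, mem_univ, true_and]
      exact ⟨hv, fun u hu hux => absurd (h.lt u hu) (by omega)⟩
    · push Not at hs
      have hJ : (s.image fun x => (x.1 : ℕ)) ⊆ range p := by
        intro j hj
        obtain ⟨x, hx, rfl⟩ := mem_image.1 hj
        exact mem_range.2 (hs x hx)
      have h1 := h.hall _ hJ
      have h2 : #s ≤ ∑ j ∈ s.image fun x => (x.1 : ℕ), (a + y j - S j) := by
        -- A class contributes at most all of its slots to `s`, without changing the candidates; so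
        -- the condition on whole classes is enough.
        have : ∀ j ∈ s.image fun x => (x.1 : ℕ), #{x ∈ s | (x.1 : ℕ) = j} ≤ a + y j - S j := by
          intro j hj
          rw [← hs1 j (mem_range.1 (hJ hj)), ← card_range (size j - S j)]
          refine card_le_card_of_injOn (fun x => x.2) (fun x hx => ?_) ?_
          · obtain ⟨-, rfl⟩ := mem_filter.1 hx
            simp
          · rintro ⟨j₁, i₁⟩ h₁ ⟨j₂, i₂⟩ h₂ hi
            have e1 := (mem_filter.1 h₁).2
            have e2 := (mem_filter.1 h₂).2
            dsimp only at e1 e2 hi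
            obtain rfl : j₁ = j₂ := Fin.ext (e1.trans e2.symm)
            rw [Fin.ext hi]
        rw [card_eq_sum_card_fiberwise (f := fun x => (x.1 : ℕ))
          (t := s.image fun x => (x.1 : ℕ)) (fun x hx => mem_coe.2 (mem_image_of_mem _ hx))]
        exact sum_le_sum this
      refine h2.trans (h1.trans (card_le_card fun v hv => ?_))
      simp only [mem_filter, mem_univ, true_and, mem_image, exists_exists_and_eq_and] at hv
      obtain ⟨hv, x, hx, hvx⟩ := hv
      simp only [mem_biUnion, t, mem_filter, mem_univ, true_and]
      exact ⟨x, hx, hv, hvx⟩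
  obtain ⟨e, he, het⟩ := (all_card_le_biUnion_card_iff_exists_injective t).1 hall
  have het' : ∀ x, e x ∉ C ∧ ∀ u ∈ C, f u = x.1 → ¬ G.Adj (e x) u := fun x => by
    simpa [t] using het x
  have himg : univ.image e = univ \ C := by
    refine eq_of_subset_of_card_le (fun v hv => ?_) ?_
    · obtain ⟨x, -, rfl⟩ := mem_image.1 hv
      simp [(het' x).1]
    · rw [card_image_of_injective _ he, card_univ, hι]
  have hex : ∀ v, ∃ j : Fin g, (v ∈ C → f v = j) ∧ (v ∉ C → ∃ x : ι, x.1 = j ∧ e x = v) := by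
    intro v
    by_cases hv : v ∈ C
    · exact ⟨⟨f v, (h.lt v hv).trans_le hp⟩, by simp, fun h => absurd hv h⟩
    · have : v ∈ univ.image e := by rw [himg]; simp [hv]
      obtain ⟨x, -, rfl⟩ := mem_image.1 this
      exact ⟨x.1, fun h => absurd h hv, fun _ => ⟨x, rfl, rfl⟩⟩
  choose col hcol1 hcol2 using hex
  -- It suffices to treat edges with a designated end in `C`, because `C` is a vertex cover.
  have hvalid : ∀ {v w}, w ∈ C → G.Adj v w → col v ≠ col w := by
    intro v w hw hvw heq
    by_cases hv : v ∈ C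
    · exact h.proper v hv w hw hvw (by rw [hcol1 v hv, hcol1 w hw, heq])
    · obtain ⟨x, hx, rfl⟩ := hcol2 v hv
      exact (het' x).2 w hw (by rw [hcol1 w hw, ← heq, hx]) hvw
  have hproper : ∀ {v w}, G.Adj v w → col v ≠ col w := fun {v w} hvw => by
    rcases hC hvw with hv | hw
    · exact (hvalid hv hvw.symm).symm
    · exact hvalid hw hvw
  let c : G.Coloring (Fin g) := .mk col hproper
  refine ⟨c, ?_⟩
  · have hsize : ∀ j : Fin g, (c.colorClass j).ncard = size j := by
      intro j
      have : c.colorClass j = ((({v ∈ C | f v = j} : Finset V) ∪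
          ({x | x.1 = j} : Finset ι).image e : Finset V) : Set V) := by
        ext v
        simp only [SimpleGraph.Coloring.colorClass, Set.mem_ofPred_eq, coe_union, coe_filter,
          coe_image, Set.mem_union, Set.mem_image, mem_univ, true_and]
        change col v = j ↔ _
        by_cases hv : v ∈ C
        · simp only [hv, true_and, hcol1 v hv, Fin.val_inj]
          refine ⟨Or.inl, ?_⟩
          rintro (h | ⟨x, -, rfl⟩)
          · exact h
          · exact absurd hv (het' x).1
        · simp only [hv, false_and, false_or]
          obtain ⟨x, hx, hxv⟩ := hcol2 v hv
          constructor
          · rintro rfl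
            exact ⟨x, hx, hxv⟩
          · rintro ⟨x', rfl, h'⟩
            rw [← hx, he (hxv.trans h'.symm)]
      rw [this, Set.ncard_coe_finset, card_union_of_disjoint, card_image_of_injective _ he]
      · have : #({x | x.1 = j} : Finset ι) = size j - S j := by
          have : ({x | x.1 = j} : Finset ι) = ({j} : Finset (Fin g)).sigma fun _ => univ := by
            ext x
            rw [mem_sigma]
            simp
          rw [this, card_sigma]
          simp
        rw [this]
        have := hSsize j j.2
        change S j + _ = _
        omega
      · rw [disjoint_left]
        intro v hv hv'
        obtain ⟨x, -, rfl⟩ := mem_image.1 hv'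
        exact (het' x).1 (mem_filter.1 hv).1
    intro i j
    rw [hsize, hsize]
    have := hs2 i i.2
    have := hs2 j j.2
    omega

/-- Take for `a` the smallest class size and for `y` the excess over it. Hall's condition is
necessary: the vertices outside `C` with colors in `J` are as many as the slots of `J`, and each is
a candidate for its own class. -/
theorem EquitablyColorableFin.exists_isPlan (h : EquitablyColorableFin G g) (hg : 0 < g)
    (hp : p ≤ g) (hCp : min g #C ≤ p) :
    ∃ a ≤ Fintype.card V, ∃ f y, IsPlan G C g p a f y := by
  classical
  obtain ⟨c, hcC, hc⟩ := h.exists_coloring_lt hp hCp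
  set s : ℕ → ℕ := fun j => #{v | (c v : ℕ) = j} with hs
  have hcs : ∀ j : Fin g, (c.colorClass j).ncard = s j := by
    intro j
    simp only [hs]
    rw [← Set.ncard_coe_finset]
    congr 1
    ext v
    simp [SimpleGraph.Coloring.colorClass, Fin.ext_iff]
  obtain ⟨i, hi0, hi⟩ := exists_min_image (range g) s ⟨0, by simpa using hg⟩
  rw [mem_range] at hi0
  have hle : ∀ j < g, s j ≤ s i + 1 := fun j hj => by
    have := hc ⟨j, hj⟩ ⟨i, hi0⟩
    rwa [hcs, hcs] at this
  have hge : ∀ j < g, s i ≤ s j := fun j hj => hi j (mem_range.2 hj)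
  have hsum : g * s i + ∑ j ∈ range g, (s j - s i) = Fintype.card V := by
    rw [sum_tsub_distrib _ (fun j hj => hi j hj), sum_const, card_range, smul_eq_mul,
      Nat.add_sub_cancel' ?_, ← card_univ]
    · exact (card_eq_sum_card_fiberwise fun v _ => mem_coe.2 (mem_range.2 (c v).2)).symm
    · rw [← smul_eq_mul, ← card_range g, ← sum_const, card_range]
      exact sum_le_sum hi
  obtain ⟨r, rfl⟩ := Nat.exists_eq_add_of_le hp
  rw [sum_range_add] at hsum
  have hr : ∑ j ∈ range r, (s (p + j) - s i) ≤ r := by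
    refine (sum_le_card_nsmul (range r) _ 1 fun j hj => ?_).trans (by simp)
    have := hle (p + j) (by have := mem_range.1 hj; omega)
    omega
  have hsize : ∀ j < p, s i + (s j - s i) = s j := fun j hj =>
    Nat.add_sub_cancel' (hge j (by omega))
  refine ⟨s i, card_le_univ _, fun v => c v, fun j => s j - s i, hcC, fun j hj => ?_, ?_, ?_, ?_,
    fun j hj => ?_, fun J hJ => ?_⟩
  · have := hle j (by omega)
    omega
  · omega
  · omega
  · exact fun u _ v _ huv h => c.valid huv (Fin.ext h)
  · rw [hsize j hj]
    exact card_le_card fun v hv => by simpa using (mem_filter.1 hv).2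
  · have h1 : ∀ j ∈ J, s i + (s j - s i) - #{v ∈ C | (c v : ℕ) = j} =
        #{v ∈ univ \ C | (c v : ℕ) = j} := by
      intro j hj
      rw [hsize j (mem_range.1 (hJ hj))]
      have : s j = #{v ∈ C | (c v : ℕ) = j} + #{v ∈ univ \ C | (c v : ℕ) = j} := by
        rw [← card_union_of_disjoint (disjoint_filter_filter disjoint_sdiff), ← filter_union,
          union_sdiff_of_subset (subset_univ _)]
      omega
    rw [sum_congr rfl h1]
    have h2 : ∀ j ∈ J, #{v ∈ univ \ C | (c v : ℕ) = j} =
        #{v ∈ ({v ∈ univ \ C | (c v : ℕ) ∈ J} : Finset V) | (c v : ℕ) = j} := by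
      intro j hj
      rw [filter_filter]
      congr 1
      refine filter_congr fun v _ => ⟨fun h => ⟨h ▸ hj, h⟩, And.right⟩
    rw [sum_congr rfl h2, ← card_eq_sum_card_fiberwise (f := fun v => (c v : ℕ)) (t := J)
      (s := {v ∈ univ \ C | (c v : ℕ) ∈ J}) fun v hv => (mem_filter.1 hv).2]
    refine card_le_card fun v hv => ?_
    simp only [mem_filter, mem_sdiff, mem_univ, true_and] at hv ⊢
    exact ⟨hv.1, c v, hv.2, fun u _ hu huv => c.valid huv (Fin.ext hu.symm)⟩

end

/-! ### Plans encoded by numbers, and the time of the exhaustive search -/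

namespace RAM

/-- The `i`-th digit of `X` in base `p`. -/
def digit (p X i : ℕ) : ℕ := X / p ^ i % p

/-- The data of the machine: the number `n` of vertices, the number `h` of colors, and a memory that
holds the adjacency matrix of the graph and the indicator function of a vertex cover. -/
structure Inst : Type where
  n : ℕ
  h : ℕ
  M : ℕ → ℕ

namespace Inst

variable (I : Inst)

def Adj (i j : ℕ) : Prop := I.M (i * I.n + j) ≠ 0

def Cov (v : ℕ) : Prop := I.M (I.n * I.n + v) ≠ 0

open Classical in
/-- The number of vertices `u < v` in the cover. -/
noncomputable def idx (v : ℕ) : ℕ := Nat.count I.Cov v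

/-- The color of `v` in the coloring of the cover that is encoded by `X`. -/
noncomputable def col (p X v : ℕ) : ℕ := digit p X (I.idx v)

open Classical in
noncomputable def classSize (p X j : ℕ) : ℕ := Nat.count (fun v => I.Cov v ∧ I.col p X v = j) I.n

/-- `v` can get one of the colors in the set encoded by `Z`. -/
def Free (p X Z v : ℕ) : Prop :=
  ¬ I.Cov v ∧ ∃ j < p, digit 2 Z j = 1 ∧ ∀ u < I.n, I.Cov u → I.col p X u = j → ¬ I.Adj v u

open Classical in
-- The binary digits of `Z` are the indicator function of the set `J` in Hall's condition.
def Hall (p a X Y Z : ℕ) : Prop :=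
  ∑ j ∈ Finset.range p, (if digit 2 Z j = 1 then a + digit 2 Y j - I.classSize p X j else 0) ≤
    Nat.count (I.Free p X Z) I.n

/-- Encoded version of `IsPlan`. -/
def Plan (g p a X Y : ℕ) : Prop :=
  g * a + ∑ j ∈ Finset.range p, digit 2 Y j ≤ I.n ∧
  I.n ≤ g * a + ∑ j ∈ Finset.range p, digit 2 Y j + (g - p) ∧
  (∀ u < I.n, ∀ v < I.n, I.Cov u → I.Cov v → I.Adj u v → I.col p X u ≠ I.col p X v) ∧
  (∀ j < p, I.classSize p X j ≤ a + digit 2 Y j) ∧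
  ∀ Z < 2 ^ p, I.Hall p a X Y Z

/-- There is a plan for `g` color classes, `p` of which may meet the cover. -/
def GoodFor (g p : ℕ) : Prop :=
  ∃ a < I.n + 1, ∃ X < p ^ I.idx I.n, ∃ Y < 2 ^ p, I.Plan g p a X Y

/-- The criterion for `g` color classes. -/
def Good (g : ℕ) : Prop := I.GoodFor g (min (I.idx I.n + 1) g)

/-- The size of the search space. -/
noncomputable def bound : ℕ := I.n + 1 + 2 ^ (I.idx I.n + 1) ^ 2

theorem n_le_bound : I.n + 1 ≤ I.bound := Nat.le_add_right _ _

theorem pow_le_bound : 2 ^ (I.idx I.n + 1) ≤ I.bound :=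
  (Nat.pow_le_pow_right two_pos (Nat.le_self_pow two_ne_zero _)).trans (Nat.le_add_left _ _)

theorem idx_le_bound : I.idx I.n + 1 ≤ I.bound := Nat.lt_two_pow_self.le.trans I.pow_le_bound

/-- With m the size of the cover, the crude estimate m + 1 ≤ 2^(m+1) suffices, at the price of an
exponent quadratic in m. -/
theorem pow_idx_le_bound {p : ℕ} (hp : p ≤ I.idx I.n + 1) : p ^ I.idx I.n ≤ I.bound := by
  refine le_trans ?_ (Nat.le_add_left _ _)
  calc p ^ I.idx I.n ≤ (2 ^ (I.idx I.n + 1)) ^ I.idx I.n :=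
        Nat.pow_le_pow_left (hp.trans Nat.lt_two_pow_self.le) _
    _ = 2 ^ ((I.idx I.n + 1) * I.idx I.n) := (pow_mul ..).symm
    _ ≤ 2 ^ (I.idx I.n + 1) ^ 2 := Nat.pow_le_pow_right two_pos (by nlinarith)

theorem idx_mono {u v : ℕ} (h : u ≤ v) : I.idx u ≤ I.idx v := by
  classical exact Nat.count_monotone _ h

end Inst

variable {Γ : Type} {c : Ctx Γ}

namespace Ctx

theorem Comp.digit {p X i : Γ → ℕ} (hp : c.Comp p) (hX : c.Comp X) (hi : c.Comp i)
    (hp0 : ∀ γ, c.ok γ → 0 < p γ) (hple : ∀ γ, c.ok γ → p γ ≤ c.bound γ)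
    (hXle : ∀ γ, c.ok γ → X γ ≤ c.bound γ) (hile : ∀ γ, c.ok γ → i γ ≤ c.bound γ) :
    c.Comp (fun γ => RAM.digit (p γ) (X γ) (i γ)) :=
  .mod (.div hX hXle (.pow hp hple hi hile) (fun γ hγ => Nat.pow_pos (hp0 γ hγ)))
    (fun γ hγ => (Nat.div_le_self _ _).trans (hXle γ hγ)) hp hp0 hple

/-- The context contains the data `I`. -/
structure Holds (c : Ctx Γ) (I : Γ → Inst) : Prop where
  n : c.Comp (fun γ => (I γ).n)
  mem : ∀ γ, c.mem γ = (I γ).M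
  n_le : ∀ γ, c.ok γ → (I γ).n ≤ c.bound γ

namespace Holds

variable {I : Γ → Inst}

theorem ext (O : c.Holds I) {Q : Γ → ℕ → Prop} : (c.ext Q).Holds (fun x => I x.1) :=
  ⟨O.n.weaken, fun x => O.mem x.1, fun x hx => O.n_le x.1 hx.1⟩

theorem load (O : c.Holds I) {a : Γ → ℕ} (ha : c.Comp a) :
    c.CompP (fun γ => (I γ).M (a γ) ≠ 0) :=
  (CompP.eq_zero ha.load).not.congr (fun γ _ => by rw [O.mem])

theorem adj (O : c.Holds I) {a b : Γ → ℕ} (ha : c.Comp a) (hb : c.Comp b)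
    (hle : ∀ γ, c.ok γ → a γ < (I γ).n) : c.CompP (fun γ => (I γ).Adj (a γ) (b γ)) :=
  O.load ((ha.mul (fun γ h => (hle γ h).le.trans (O.n_le γ h)) O.n).add hb)

theorem covAddr (O : c.Holds I) {a : Γ → ℕ} (ha : c.Comp a) :
    c.Comp (fun γ => (I γ).n * (I γ).n + a γ) :=
  (O.n.mul O.n_le O.n).add ha

theorem cov (O : c.Holds I) {a : Γ → ℕ} (ha : c.Comp a) : c.CompP (fun γ => (I γ).Cov (a γ)) :=
  O.load (O.covAddr ha)

end Holds

/-- The context contains the data `I`, and its bound is at least the size of the search space. -/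
structure Over (c : Ctx Γ) (I : Γ → Inst) : Prop extends c.Holds I where
  le : ∀ γ, c.ok γ → (I γ).bound ≤ c.bound γ

namespace Over

variable {I : Γ → Inst}

theorem ext (O : c.Over I) {Q : Γ → ℕ → Prop} : (c.ext Q).Over (fun x => I x.1) :=
  ⟨O.toHolds.ext, fun x hx => O.le x.1 hx.1⟩

theorem n_lt (O : c.Over I) {γ : Γ} (h : c.ok γ) : (I γ).n < c.bound γ :=
  (I γ).n_le_bound.trans (O.le γ h)

theorem two_le (O : c.Over I) {γ : Γ} (h : c.ok γ) : 2 ≤ c.bound γ :=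
  (Nat.pow_le_pow_right two_pos (Nat.succ_pos _)).trans ((I γ).pow_le_bound.trans (O.le γ h))

theorem idx (O : c.Over I) {v : Γ → ℕ} (hv : c.Comp v) (hle : ∀ γ, c.ok γ → v γ ≤ (I γ).n) :
    c.Comp (fun γ => (I γ).idx (v γ)) := by
  classical
  exact (Comp.count (P := fun γ u => (I γ).Cov u) hv (fun γ h => (hle γ h).trans (O.n_le γ h))
    (O.ext.cov .last)).congr (fun γ _ => by unfold Inst.idx; congr)

/-- The parameters `p` and `X` encode a coloring of the cover. -/
structure Coloring (c : Ctx Γ) (I : Γ → Inst) (p X : Γ → ℕ) : Prop where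
  comp_p : c.Comp p
  comp_X : c.Comp X
  pos : ∀ γ, c.ok γ → 0 < p γ
  le : ∀ γ, c.ok γ → p γ ≤ (I γ).idx (I γ).n + 1
  lt : ∀ γ, c.ok γ → X γ < p γ ^ (I γ).idx (I γ).n

variable {p X : Γ → ℕ}

theorem Coloring.ext (H : Coloring c I p X) {Q : Γ → ℕ → Prop} :
    Coloring (c.ext Q) (fun x => I x.1) (fun x => p x.1) (fun x => X x.1) :=
  ⟨H.comp_p.weaken, H.comp_X.weaken, fun _ h => H.pos _ h.1, fun _ h => H.le _ h.1,
    fun _ h => H.lt _ h.1⟩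

theorem p_le (O : c.Over I) (H : Coloring c I p X) {γ : Γ} (h : c.ok γ) : p γ ≤ c.bound γ :=
  (H.le γ h).trans ((I γ).idx_le_bound.trans (O.le γ h))

theorem two_pow_le (O : c.Over I) (H : Coloring c I p X) {γ : Γ} (h : c.ok γ) :
    2 ^ p γ ≤ c.bound γ :=
  (Nat.pow_le_pow_right two_pos (H.le γ h)).trans ((I γ).pow_le_bound.trans (O.le γ h))

theorem col (O : c.Over I) (H : Coloring c I p X) {v : Γ → ℕ} (hv : c.Comp v)
    (hle : ∀ γ, c.ok γ → v γ ≤ (I γ).n) : c.Comp (fun γ => (I γ).col (p γ) (X γ) (v γ)) :=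
  .digit H.comp_p H.comp_X (O.idx hv hle) H.pos (fun _ h => O.p_le H h)
    (fun γ h => (H.lt γ h).le.trans (((I γ).pow_idx_le_bound (H.le γ h)).trans (O.le γ h)))
    (fun γ h => ((I γ).idx_mono (hle γ h)).trans
      ((Nat.le_succ _).trans ((I γ).idx_le_bound.trans (O.le γ h))))

theorem bit (O : c.Over I) (H : Coloring c I p X) {Z j : Γ → ℕ} (hZ : c.Comp Z) (hj : c.Comp j)
    (hZle : ∀ γ, c.ok γ → Z γ < 2 ^ p γ) (hjle : ∀ γ, c.ok γ → j γ < p γ) :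
    c.Comp (fun γ => RAM.digit 2 (Z γ) (j γ)) :=
  .digit (.const 2) hZ hj (fun _ _ => two_pos) (fun _ h => O.two_le h)
    (fun γ h => (hZle γ h).le.trans (O.two_pow_le H h))
    (fun γ h => (hjle γ h).le.trans (O.p_le H h))

theorem classSize (O : c.Over I) (H : Coloring c I p X) {j : Γ → ℕ} (hj : c.Comp j) :
    c.Comp (fun γ => (I γ).classSize (p γ) (X γ) (j γ)) := by
  classical
  exact (Comp.count (P := fun γ v => (I γ).Cov v ∧ (I γ).col (p γ) (X γ) v = j γ) O.n O.n_le
    ((O.ext.cov .last).and (.eq (O.ext.col H.ext .last fun x h => h.2.le) hj.weaken))).congr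
    (fun γ _ => by unfold Inst.classSize; congr)

theorem free (O : c.Over I) (H : Coloring c I p X) {Z v : Γ → ℕ} (hZ : c.Comp Z)
    (hZle : ∀ γ, c.ok γ → Z γ < 2 ^ p γ) (hv : c.Comp v) (hvle : ∀ γ, c.ok γ → v γ < (I γ).n) :
    c.CompP (fun γ => (I γ).Free (p γ) (X γ) (Z γ) (v γ)) := by
  refine (O.cov hv).not.and (.ex (P := fun γ j => RAM.digit 2 (Z γ) j = 1 ∧
    ∀ u < (I γ).n, (I γ).Cov u → (I γ).col (p γ) (X γ) u = j → ¬ (I γ).Adj (v γ) u)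
    H.comp_p (fun _ h => O.p_le H h) ?_)
  refine (CompP.eq (O.ext.bit H.ext hZ.weaken .last (fun x h => hZle _ h.1) (fun x h => h.2))
    (.const 1)).and (.all (P := fun γ u => (I γ.1).Cov u →
      (I γ.1).col (p γ.1) (X γ.1) u = γ.2 → ¬ (I γ.1).Adj (v γ.1) u) O.ext.n O.ext.n_le ?_)
  refine (O.ext.ext.cov .last).imp (.imp (.eq (O.ext.ext.col H.ext.ext .last fun x h => h.2.le)
    (Comp.weaken .last)) (O.ext.ext.adj hv.weaken.weaken .last fun x h => hvle _ h.1.1).not)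

theorem hall (O : c.Over I) (H : Coloring c I p X) {a Y Z : Γ → ℕ} (ha : c.Comp a)
    (hY : c.Comp Y) (hYle : ∀ γ, c.ok γ → Y γ < 2 ^ p γ) (hZ : c.Comp Z)
    (hZle : ∀ γ, c.ok γ → Z γ < 2 ^ p γ) :
    c.CompP (fun γ => (I γ).Hall (p γ) (a γ) (X γ) (Y γ) (Z γ)) := by
  classical
  refine (CompP.le (.sum (F := fun γ j => if RAM.digit 2 (Z γ) j = 1 then
    a γ + RAM.digit 2 (Y γ) j - (I γ).classSize (p γ) (X γ) j else 0) H.comp_p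
    (fun _ h => O.p_le H h) ?_) (.count (P := fun γ v => (I γ).Free (p γ) (X γ) (Z γ) v)
      O.n O.n_le (O.ext.free H.ext hZ.weaken (fun x h => hZle _ h.1) .last
        (fun x h => h.2)))).congr (fun γ _ => ?_)
  · exact .ite (.eq (O.ext.bit H.ext hZ.weaken .last (fun x h => hZle _ h.1) (fun x h => h.2))
      (.const 1)) (.sub (.add ha.weaken (O.ext.bit H.ext hY.weaken .last (fun x h => hYle _ h.1)
        (fun x h => h.2))) (O.ext.classSize H.ext .last)) (.const 0)
  · unfold Inst.Hall
    congr!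

theorem plan (O : c.Over I) (H : Coloring c I p X) {g a Y : Γ → ℕ} (hg : c.Comp g)
    (hgle : ∀ γ, c.ok γ → g γ ≤ (I γ).n) (ha : c.Comp a)
    (hY : c.Comp Y) (hYle : ∀ γ, c.ok γ → Y γ < 2 ^ p γ) :
    c.CompP (fun γ => (I γ).Plan (g γ) (p γ) (a γ) (X γ) (Y γ)) := by
  have hsum : c.Comp (fun γ => g γ * a γ + ∑ j ∈ Finset.range (p γ), RAM.digit 2 (Y γ) j) :=
    .add (.mul hg (fun γ h => (hgle γ h).trans (O.n_le γ h)) ha)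
      (.sum (F := fun γ j => RAM.digit 2 (Y γ) j) H.comp_p (fun _ h => O.p_le H h)
        (O.ext.bit H.ext hY.weaken .last (fun x h => hYle _ h.1) (fun x h => h.2)))
  refine (CompP.le hsum O.n).and (.and (.le O.n (.add hsum (.sub hg H.comp_p))) (.and ?_ (.and ?_ ?_)))
  · refine .all (P := fun γ u => ∀ v < (I γ).n, (I γ).Cov u → (I γ).Cov v → (I γ).Adj u v →
      (I γ).col (p γ) (X γ) u ≠ (I γ).col (p γ) (X γ) v) O.n O.n_le
      (.all (P := fun γ v => (I γ.1).Cov γ.2 → (I γ.1).Cov v → (I γ.1).Adj γ.2 v →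
      (I γ.1).col (p γ.1) (X γ.1) γ.2 ≠ (I γ.1).col (p γ.1) (X γ.1) v) O.ext.n O.ext.n_le ?_)
    exact (O.ext.ext.cov (Comp.weaken .last)).imp (.imp (O.ext.ext.cov .last)
      (.imp (O.ext.ext.adj (Comp.weaken .last) .last fun x h => h.1.2) (CompP.not (.eq
        (O.ext.ext.col H.ext.ext (Comp.weaken .last) fun x h => h.1.2.le)
        (O.ext.ext.col H.ext.ext .last fun x h => h.2.le)))))
  · exact .all (P := fun γ j => (I γ).classSize (p γ) (X γ) j ≤ a γ + RAM.digit 2 (Y γ) j) H.comp_p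
      (fun _ h => O.p_le H h) (.le (O.ext.classSize H.ext .last) (.add ha.weaken
        (O.ext.bit H.ext hY.weaken .last (fun x h => hYle _ h.1) (fun x h => h.2))))
  · exact .all (P := fun γ Z => (I γ).Hall (p γ) (a γ) (X γ) (Y γ) Z)
      (.pow (.const 2) (fun _ h => O.two_le h) H.comp_p (fun _ h => O.p_le H h))
      (fun _ h => O.two_pow_le H h)
      (O.ext.hall H.ext ha.weaken hY.weaken (fun x h => hYle _ h.1) .last (fun x h => h.2))

/-- Each quantifier ranges over numbers below the bound, and the nesting depth is fixed, so trying
all values is polynomial in the bound. -/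
theorem goodFor (O : c.Over I) {g p : Γ → ℕ} (hg : c.Comp g)
    (hgle : ∀ γ, c.ok γ → g γ ≤ (I γ).n) (hp : c.Comp p) (hpos : ∀ γ, c.ok γ → 0 < p γ)
    (hple : ∀ γ, c.ok γ → p γ ≤ (I γ).idx (I γ).n + 1) :
    c.CompP (fun γ => (I γ).GoodFor (g γ) (p γ)) := by
  have hm : c.Comp (fun γ => (I γ).idx (I γ).n) := O.idx O.n (fun _ _ => le_rfl)
  have hmle : ∀ γ, c.ok γ → (I γ).idx (I γ).n + 1 ≤ c.bound γ := fun γ h =>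
    (I γ).idx_le_bound.trans (O.le γ h)
  refine .ex (P := fun γ a => ∃ X < p γ ^ (I γ).idx (I γ).n, ∃ Y < 2 ^ p γ,
    (I γ).Plan (g γ) (p γ) a X Y) (O.n.add (.const 1)) (fun γ h => O.n_lt h) ?_
  refine .ex (P := fun γ X => ∃ Y < 2 ^ p γ.1, (I γ.1).Plan (g γ.1) (p γ.1) γ.2 X Y)
    (.pow hp.weaken (fun x h => (hple _ h.1).trans (hmle _ h.1)) hm.weaken
      (fun x h => (Nat.le_succ _).trans (hmle _ h.1)))
    (fun x h => ((I x.1).pow_idx_le_bound (hple _ h.1)).trans (O.le _ h.1)) ?_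
  have H : Coloring ((c.ext fun γ a => a < (I γ).n + 1).ext fun x X =>
      X < p x.1 ^ (I x.1).idx (I x.1).n) (fun x => I x.1.1) (fun x => p x.1.1) (fun x => x.2) :=
    ⟨hp.weaken.weaken, .last, fun x h => hpos _ h.1.1, fun x h => hple _ h.1.1, fun x h => h.2⟩
  exact .ex (P := fun γ Y => (I γ.1.1).Plan (g γ.1.1) (p γ.1.1) γ.1.2 γ.2 Y)
    (.pow (.const 2) (fun _ h => O.ext.ext.two_le h) H.comp_p (fun _ h => O.ext.ext.p_le H h))
    (fun _ h => O.ext.ext.two_pow_le H h)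
    (O.ext.ext.ext.plan H.ext hg.weaken.weaken.weaken (fun x h => hgle _ h.1.1.1)
      (Comp.weaken (Comp.weaken .last)) .last (fun x h => h.2))

/-- The `+ 1` in `p` keeps the base of the digits positive when the cover is empty. -/
theorem good (O : c.Over I) {g : Γ → ℕ} (hg : c.Comp g) (hpos : ∀ γ, c.ok γ → 0 < g γ)
    (hgle : ∀ γ, c.ok γ → g γ ≤ (I γ).n) : c.CompP (fun γ => (I γ).Good (g γ)) :=
  O.goodFor hg hgle (((O.idx O.n fun _ _ => le_rfl).add (.const 1)).min hg)
    (fun γ h => lt_min (Nat.succ_pos _) (hpos γ h)) (fun _ _ => min_le_left _ _)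

end Over

end Ctx

end RAM

/-! ### Correctness of the encoding -/

namespace RAM

theorem digit_lt {p : ℕ} (hp : 0 < p) (X i : ℕ) : digit p X i < p := Nat.mod_lt _ hp

theorem exists_digits {p m : ℕ} (F : ℕ → ℕ) (hF : ∀ i < m, F i < p) :
    ∃ X < p ^ m, ∀ i < m, digit p X i = F i := by
  refine ⟨finFunctionFinEquiv (fun i : Fin m => (⟨F i, hF i i.2⟩ : Fin p)), Fin.is_lt _,
    fun i hi => ?_⟩
  have := congrArg Fin.val (congrFun (finFunctionFinEquiv.symm_apply_apply
    (fun i : Fin m => (⟨F i, hF i i.2⟩ : Fin p))) ⟨i, hi⟩)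
  exact this

theorem count_eq_card_fin (P : ℕ → Prop) [DecidablePred P] (n : ℕ) :
    Nat.count P n = (Finset.univ.filter fun v : Fin n => P v).card := by
  rw [Nat.count_eq_card_filter_range, ← Finset.card_map Fin.valEmbedding]
  congr 1
  ext x
  simp [Fin.exists_iff, and_comm]

open Classical in
/-- The memory that holds the adjacency matrix of `G` and, behind it, the indicator function of the
set `C` of vertices. -/
noncomputable def coverMem {n : ℕ} (G : SimpleGraph (Fin n)) (C : Finset (Fin n)) (x : ℕ) : ℕ :=
  if (∃ i j : Fin n, G.Adj i j ∧ x = i * n + j) ∨ ∃ v ∈ C, x = n * n + v then 1 else 0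

/-- The data `G`, `h` and `C`. -/
noncomputable def inst {n : ℕ} (G : SimpleGraph (Fin n)) (h : ℕ) (C : Finset (Fin n)) : Inst :=
  ⟨n, h, coverMem G C⟩

section

variable {n : ℕ} {G : SimpleGraph (Fin n)} {h : ℕ} {C : Finset (Fin n)}

theorem input_mem : (input G h).mem = coverMem G ∅ := by
  classical
  ext x
  exact if_congr (by simp) rfl rfl

theorem update_coverMem (v : Fin n) :
    Function.update (coverMem G C) (n * n + v) 1 = coverMem G (insert v C) := by
  classical
  ext x
  by_cases hx : x = n * n + v
  · subst hx
    simp [coverMem]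
  · rw [Function.update_of_ne hx]
    exact if_congr (by simp [hx]) rfl rfl

theorem adj_addr_lt (i j : Fin n) : (i : ℕ) * n + j < n * n := by
  have := i.2
  have := j.2
  nlinarith

/-- The matrix lies in the cells below `n * n`, apart from the cover, and division by `n` with
remainder recovers row and column from an address. -/
theorem inst_adj (i j : Fin n) : (inst G h C).Adj i j ↔ G.Adj i j := by
  have h1 : ∀ v : Fin n, (i : ℕ) * n + j ≠ n * n + v := fun v => by
    have := adj_addr_lt i j
    omega
  have h2 : ∀ i' j' : Fin n, (i : ℕ) * n + j = i' * n + j' → i = i' ∧ j = j' := by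
    intro i' j' he
    have hn : 0 < n := i.pos
    have e1 := congrArg (· / n) he
    have e2 := congrArg (· % n) he
    simp only [mul_comm _ n, Nat.mul_add_div hn, Nat.mul_add_mod, Nat.div_eq_of_lt j.2,
      Nat.div_eq_of_lt j'.2, Nat.mod_eq_of_lt j.2, Nat.mod_eq_of_lt j'.2, add_zero] at e1 e2
    exact ⟨Fin.ext e1, Fin.ext e2⟩
  simp only [Inst.Adj, inst, coverMem, h1, and_false, exists_false, or_false, ne_eq,
    ite_eq_right_iff, one_ne_zero, imp_false, not_not]
  constructor
  · rintro ⟨i', j', ha, he⟩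
    obtain ⟨rfl, rfl⟩ := h2 i' j' he
    exact ha
  · exact fun ha => ⟨i, j, ha, rfl⟩

theorem inst_cov (v : Fin n) : (inst G h C).Cov v ↔ v ∈ C := by
  have h1 : ∀ i j : Fin n, n * n + (v : ℕ) ≠ i * n + j := fun i j => by
    have := adj_addr_lt i j
    omega
  simp [Inst.Cov, inst, coverMem, h1, Fin.val_inj]

theorem inst_idx : (inst G h C).idx n = C.card := by
  classical
  rw [Inst.idx, count_eq_card_fin]
  congr 1
  ext v
  simp [inst_cov]

theorem idx_lt {v : Fin n} (hv : v ∈ C) : (inst G h C).idx v < C.card := by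
  classical
  rw [← inst_idx (G := G) (h := h)]
  exact Nat.count_strict_mono ((inst_cov v).2 hv) v.2

theorem idx_injOn {u v : Fin n} (hu : u ∈ C) (hv : v ∈ C)
    (huv : (inst G h C).idx u = (inst G h C).idx v) : u = v := by
  classical
  exact Fin.ext (Nat.count_injective ((inst_cov u).2 hu) ((inst_cov v).2 hv) huv)

variable {g p a X Y : ℕ} {f : Fin n → ℕ} {y : ℕ → ℕ}

theorem classSize_eq (hf : ∀ v ∈ C, f v = (inst G h C).col p X v) (j : ℕ) :
    (inst G h C).classSize p X j = (C.filter fun v => f v = j).card := by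
  classical
  rw [Inst.classSize, show (inst G h C).n = n from rfl, count_eq_card_fin]
  congr 1
  ext v
  simp only [Finset.mem_filter, Finset.mem_univ, true_and, inst_cov]
  exact and_congr_right fun hv => by rw [hf v hv]

/-- Only the values of `f` on `C` and of `y` below `p` matter. The numbers `Z < 2 ^ p` run through
all subsets of `range p`. -/
theorem plan_iff (hf : ∀ v ∈ C, f v = (inst G h C).col p X v)
    (hy : ∀ j < p, y j = digit 2 Y j) (hp : 0 < p) :
    (inst G h C).Plan g p a X Y ↔ IsPlan G C g p a f y := by
  classical
  have hsum : ∑ j ∈ Finset.range p, digit 2 Y j = ∑ j ∈ Finset.range p, y j :=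
    Finset.sum_congr rfl fun j hj => (hy j (Finset.mem_range.1 hj)).symm
  have hn : (inst G h C).n = n := rfl
  have hproper : (∀ u < n, ∀ v < n, (inst G h C).Cov u → (inst G h C).Cov v →
      (inst G h C).Adj u v → (inst G h C).col p X u ≠ (inst G h C).col p X v) ↔
      ∀ u ∈ C, ∀ v ∈ C, G.Adj u v → f u ≠ f v := by
    constructor
    · intro H u hu v hv huv
      rw [hf u hu, hf v hv]
      exact H u u.2 v v.2 ((inst_cov u).2 hu) ((inst_cov v).2 hv) ((inst_adj u v).2 huv)
    · intro H u hu v hv hcu hcv huv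
      have hcu' := (inst_cov ⟨u, hu⟩).1 hcu
      have hcv' := (inst_cov ⟨v, hv⟩).1 hcv
      have := H _ hcu' _ hcv' ((inst_adj ⟨u, hu⟩ ⟨v, hv⟩).1 huv)
      rwa [hf _ hcu', hf _ hcv'] at this
  have hfits : (∀ j < p, (inst G h C).classSize p X j ≤ a + digit 2 Y j) ↔
      ∀ j < p, (C.filter fun v => f v = j).card ≤ a + y j :=
    forall₂_congr fun j hj => by rw [classSize_eq hf, hy j hj]
  have hfree : ∀ Z J, (∀ j, j ∈ J ↔ j < p ∧ digit 2 Z j = 1) →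
      ((inst G h C).Hall p a X Y Z ↔
        ∑ j ∈ J, (a + y j - (C.filter fun v => f v = j).card) ≤
        (Finset.univ.filter fun v => v ∉ C ∧ ∃ j ∈ J, ∀ u ∈ C, f u = j → ¬ G.Adj v u).card) := by
    intro Z J hJ
    have h1 : J = (Finset.range p).filter fun j => digit 2 Z j = 1 := by
      ext j
      simp [hJ]
    rw [Inst.Hall, ← Finset.sum_filter, ← h1, hn, count_eq_card_fin]
    have h2 : ∀ j ∈ J, a + digit 2 Y j - (inst G h C).classSize p X j =
        a + y j - (C.filter fun v => f v = j).card := fun j hj => by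
      rw [classSize_eq hf, hy j ((hJ j).1 hj).1]
    rw [Finset.sum_congr rfl h2]
    have h3 : ∀ v : Fin n, (inst G h C).Free p X Z v ↔
        v ∉ C ∧ ∃ j ∈ J, ∀ u ∈ C, f u = j → ¬ G.Adj v u := by
      intro v
      rw [Inst.Free, inst_cov]
      refine and_congr_right fun _ => exists_congr fun j => ?_
      rw [hJ, and_assoc]
      refine and_congr_right fun _ => and_congr_right fun _ => ⟨fun H u hu huj => ?_,
        fun H u hu hcu huj => ?_⟩
      · rw [← inst_adj (h := h) (C := C)]
        exact H u u.2 ((inst_cov u).2 hu) ((hf u hu).symm.trans huj)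
      · have hcu' := (inst_cov ⟨u, hu⟩).1 hcu
        exact fun hadj => H ⟨u, hu⟩ hcu' ((hf _ hcu').trans huj) ((inst_adj v ⟨u, hu⟩).1 hadj)
    simp only [h3]
  rw [Inst.Plan, hsum, hn, hproper, hfits]
  constructor
  · rintro ⟨h1, h2, h3, h4, h5⟩
    refine ⟨fun v hv => ?_, fun j hj => ?_, by simpa using h1, by simpa using h2, h3,
      fun j hj => ?_, fun J hJ => ?_⟩
    · rw [hf v hv]
      exact digit_lt hp _ _
    · rw [hy j hj]
      exact Nat.le_of_lt_succ (digit_lt two_pos _ _)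
    · convert h4 j hj
    · obtain ⟨Z, hZ, hZJ⟩ := exists_digits (p := 2) (m := p) (fun j => if j ∈ J then 1 else 0)
        (fun i _ => by split_ifs <;> omega)
      convert (hfree Z J fun j => ?_).1 (h5 Z hZ)
      constructor
      · intro hj
        have := Finset.mem_range.1 (hJ hj)
        exact ⟨this, by rw [hZJ j this, if_pos hj]⟩
      · rintro ⟨hj, hd⟩
        rw [hZJ j hj] at hd
        by_contra hjJ
        simp [hjJ] at hd
  · rintro ⟨-, -, h1, h2, h3, h4, h5⟩
    refine ⟨by simpa using h1, by simpa using h2, h3, fun j hj => ?_, fun Z hZ => ?_⟩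
    · convert h4 j hj
    · rw [hfree Z ((Finset.range p).filter fun j => digit 2 Z j = 1) fun j => by simp]
      convert h5 _ (Finset.filter_subset _ _)

theorem good_iff (hC : G.IsVertexCover C) (hg : 0 < g) :
    (inst G h C).Good g ↔ EquitablyColorableFin G g := by
  have hn : (inst G h C).n = n := rfl
  rw [Inst.Good, Inst.GoodFor, hn, inst_idx]
  have hp0 : 0 < min (C.card + 1) g := lt_min (Nat.succ_pos _) hg
  constructor
  · rintro ⟨a, -, X, -, Y, -, H⟩
    exact ((plan_iff (f := fun v => (inst G h C).col (min (C.card + 1) g) X v)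
      (y := digit 2 Y) (fun _ _ => rfl) (fun _ _ => rfl) hp0).1 H).colorable (min_le_right _ _) hC
  · intro H
    obtain ⟨a, ha, f, y, hP⟩ := H.exists_isPlan (C := C) (p := min (C.card + 1) g) hg
      (min_le_right _ _) (by omega)
    rw [Fintype.card_fin] at ha
    classical
    -- The digit at place `i` is the color of the cover vertex with index `i`; places without such a
    -- vertex are filled with 0.
    have hF : ∀ i, ∃ x < min (C.card + 1) g, ∀ v ∈ C, (inst G h C).idx v = i → x = f v := by
      intro i
      by_cases hi : ∃ v ∈ C, (inst G h C).idx v = i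
      · obtain ⟨v, hv, rfl⟩ := hi
        exact ⟨f v, hP.lt v hv, fun u hu huv => by rw [idx_injOn hu hv huv]⟩
      · exact ⟨0, hp0, fun v hv hvi => absurd ⟨v, hv, hvi⟩ hi⟩
    choose F hF1 hF2 using hF
    obtain ⟨X, hX, hXF⟩ := exists_digits (m := C.card) F fun i _ => hF1 i
    obtain ⟨Y, hY, hYy⟩ := exists_digits (p := 2) (m := min (C.card + 1) g) y
      fun j hj => Nat.lt_succ_of_le (hP.le_one j hj)
    refine ⟨a, Nat.lt_succ_of_le ha, X, hX, Y, hY, (plan_iff (fun v hv => ?_)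
      (fun j hj => (hYy j hj).symm) hp0).2 hP⟩
    rw [Inst.col, hXF _ (idx_lt hv)]
    exact (hF2 _ v hv rfl).symm

end

end RAM

/-! ### Greedy search for a vertex cover -/

namespace RAM

/-- The number of vertices, the number of colors and the memory, with running times measured in
terms of the number of vertices. -/
def graphCtx : Ctx Inst where
  len := 2
  var r I := if r = 0 then I.n else I.h
  mem I := I.M
  bound I := I.n
  ok _ := True

/-- The same, with running times measured in terms of the size of the search space. -/
noncomputable def searchCtx : Ctx Inst where
  len := 2
  var r I := if r = 0 then I.n else I.h
  mem I := I.M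
  bound I := I.bound
  ok _ := True

theorem graphCtx_holds : graphCtx.Holds (fun I => I) :=
  ⟨Ctx.Comp.var (c := graphCtx) (r := 0) two_pos, fun _ => rfl, fun _ _ => le_rfl⟩

theorem searchCtx_over : searchCtx.Over (fun I => I) :=
  ⟨⟨Ctx.Comp.var (c := searchCtx) (r := 0) two_pos, fun _ => rfl,
    fun I _ => (Nat.le_succ _).trans I.n_le_bound⟩, fun _ _ => le_rfl⟩

theorem searchCtx_h : searchCtx.Comp (fun I => I.h) :=
  Ctx.Comp.var (c := searchCtx) (r := 1) one_lt_two

/-- Store the number `1` in a cell with computable address. -/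
theorem Ctx.Comp.exists_store_one {Γ : Type} {c : Ctx Γ} {a : Γ → ℕ} (ha : c.Comp a) {pos : ℕ → ℕ}
    {d : ℕ} (hpos : ∀ r < c.len, pos r < d) : ∃ p T, c.Poly T ∧ ∀ γ s, c.Rep pos γ s →
      Runs p s (T γ) (fun s' => s'.mem = Function.update s.mem (a γ) 1 ∧
        ∀ r < d, s'.reg r = s.reg r) := by
  obtain ⟨p, T, hT, h⟩ := ha pos d hpos
  refine ⟨.seq p (.seq (.const (d + 1) 1) (.store d (d + 1))), fun γ => T γ + (1 + 1),
    hT.add (.const 2), fun γ s hs => (h γ s hs).seq fun s₁ ⟨h1, h2⟩ => ?_⟩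
  refine (Runs.const (Q := fun s' => s' = s₁.setReg (d + 1) 1) rfl).seq ?_
  rintro _ rfl
  refine .store ⟨?_, fun r hr => ?_⟩
  · simp [State.setMem, State.setReg, h1, h2.2]
  · simp [State.setMem, State.setReg, Function.update, show r ≠ d + 1 by omega, h2.1 r hr]

section

variable {n : ℕ} {G : SimpleGraph (Fin n)} {h : ℕ} {C : Finset (Fin n)}

/-- Every vertex cover has at least half of its size in `C`, as if `C` is the set of vertices of a
matching. -/
def IsTight (G : SimpleGraph (Fin n)) (C : Finset (Fin n)) : Prop :=
  ∀ S : Finset (Fin n), G.IsVertexCover S → C.card ≤ 2 * (S ∩ C).card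

/-- A vertex cover contains `u` or `v`, and neither was in `C`: while `C` grows by two, the
intersection grows by at least one. -/
theorem IsTight.insert (hC : IsTight G C) {u v : Fin n} (huv : G.Adj u v) (hu : u ∉ C)
    (hv : v ∉ C) : IsTight G (insert v (insert u C)) := by
  intro S hS
  have h1 := hC S hS
  have hne := huv.ne
  rw [Finset.card_insert_of_notMem (by simp [hne.symm, hv]), Finset.card_insert_of_notMem hu]
  have h2 : (S ∩ C).card + 1 ≤ (S ∩ Insert.insert v (Insert.insert u C)).card := by
    obtain ⟨w, hwS, hwC, hw⟩ : ∃ w ∈ S, w ∉ C ∧ (w = u ∨ w = v) := by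
      rcases hS huv with h | h
      exacts [⟨u, h, hu, .inl rfl⟩, ⟨v, h, hv, .inr rfl⟩]
    rw [← Finset.card_insert_of_notMem (a := w) (s := S ∩ C) (by simp [hwC])]
    refine Finset.card_le_card fun x hx => ?_
    simp only [Finset.mem_insert, Finset.mem_inter] at hx ⊢
    rcases hx with rfl | hx
    · exact ⟨hwS, by tauto⟩
    · exact ⟨hx.1, by tauto⟩
  omega

/-- The state of the greedy search for a vertex cover: the edges `u v` with `u < i` and with `u = i`,
`v < j` are covered. -/
def Greedy (G : SimpleGraph (Fin n)) (h i j : ℕ) (s : State) : Prop :=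
  s.reg 0 = n ∧ s.reg 1 = h ∧ ∃ C, s.mem = coverMem G C ∧ IsTight G C ∧
    ∀ u v : Fin n, ((u : ℕ) < i ∨ (u : ℕ) = i ∧ (v : ℕ) < j) → G.Adj u v → u ∈ C ∨ v ∈ C

theorem Greedy.congr {i j : ℕ} {s s' : State} (H : Greedy G h i j s)
    (hr : ∀ r < 2, s'.reg r = s.reg r) (hm : s'.mem = s.mem) : Greedy G h i j s' :=
  ⟨(hr 0 two_pos).trans H.1, (hr 1 one_lt_two).trans H.2.1, by rw [hm]; exact H.2.2⟩

theorem exists_greedy_step : ∃ p A e, ∀ (n : ℕ) (G : SimpleGraph (Fin n)) (h i j : ℕ), i < n →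
    j < n → ∀ s, Greedy G h i j s → s.reg 2 = i → s.reg 4 = j →
    Runs p s (A * (n + 1) ^ e) (fun s' => Greedy G h i (j + 1) s' ∧
      ∀ r < 6, s'.reg r = s.reg r) := by
  let c := (graphCtx.ext fun I i => i < I.n).ext fun x j => j < x.1.n
  -- `n`, `h`, `i`, `j` are in registers 0, 1, 2, 4. Registers 3 and 5 hold the rounds left of the
  -- two loops, and scratch space begins at 6.
  let pos : ℕ → ℕ := fun r => if r < 3 then if r < 2 then r else 2 else 4
  have hpos : ∀ r < c.len, pos r < 6 := fun r _ => by simp only [pos]; split_ifs <;> omega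
  have O : c.Holds (fun x => x.1.1) := graphCtx_holds.ext.ext
  have hi : c.Comp (fun x => x.1.2) := .weaken .last
  have hj : c.Comp (fun x => x.2) := .last
  have hcond : c.CompP (fun x => x.1.1.Adj x.1.2 x.2 ∧ ¬ x.1.1.Cov x.1.2 ∧ ¬ x.1.1.Cov x.2) :=
    (O.adj hi hj fun x hx => hx.1.2).and ((O.cov hi).not.and (O.cov hj).not)
  obtain ⟨p, T, hT, hp⟩ := hcond pos 6 hpos
  obtain ⟨p₁, T₁, hT₁, hp₁⟩ := (O.covAddr hi).exists_store_one hpos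
  obtain ⟨p₂, T₂, hT₂, hp₂⟩ := (O.covAddr hj).exists_store_one hpos
  obtain ⟨A, e, hA⟩ := hT.add hT₁
  -- The extra 2 is slack: after subtracting 1, the budget still covers the second store as well as
  -- the one instruction of the other branch.
  obtain ⟨A₂, e₂, hA₂⟩ := hT₂.add (.const 2)
  refine ⟨.seq p (.ite 6 (.seq p₁ p₂) (.const 6 0)), A + A₂, e + e₂,
    fun n G h i j hin hjn s H hi2 hj4 => ?_⟩
  -- Stated for every `C`, since it is needed again after the first store, when `i` has joined the
  -- cover.
  have hrep : ∀ s C, s.reg 0 = n → s.reg 1 = h → s.reg 2 = i → s.reg 4 = j →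
      s.mem = coverMem G C → c.Rep pos ((inst G h C, i), j) s := by
    intro s C h0 h1 h2 h4 hm
    refine ⟨⟨⟨trivial, hin⟩, hjn⟩, fun r hr => ?_, hm⟩
    have hr : r < 4 := hr
    interval_cases r <;> simp [c, pos, Ctx.ext, graphCtx, inst, *]
  obtain ⟨h0, h1, C, hm, hC, hcov⟩ := H
  have hrs := hrep s C h0 h1 hi2 hj4 hm
  have hcost : T ((inst G h C, i), j) + T₁ ((inst G h C, i), j) ≤ A * (n + 1) ^ e := hA _ hrs.1
  have hcost₂ : ∀ C', T₂ ((inst G h C', i), j) + 2 ≤ A₂ * (n + 1) ^ e₂ := fun C' =>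
    hA₂ ((inst G h C', i), j) hrs.1
  have hcost' : T ((inst G h C, i), j) + (T₁ ((inst G h C, i), j) + (A₂ * (n + 1) ^ e₂ - 1) + 1) ≤
      (A + A₂) * (n + 1) ^ (e + e₂) := by
    have e1 : A * (n + 1) ^ e ≤ A * (n + 1) ^ (e + e₂) :=
      Nat.mul_le_mul_left _ (Nat.pow_le_pow_right (by omega) (by omega))
    have e2 : A₂ * (n + 1) ^ e₂ ≤ A₂ * (n + 1) ^ (e + e₂) :=
      Nat.mul_le_mul_left _ (Nat.pow_le_pow_right (by omega) (by omega))
    have := hcost₂ C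
    rw [add_mul]
    omega
  refine (((hp _ s hrs).seq fun s₁ ⟨hs₁, hsb⟩ => ?_)).mono hcost' fun _ => id
  have hadj : ∀ u v : Fin n, (u : ℕ) < i ∨ (u : ℕ) = i ∧ (v : ℕ) < j + 1 → G.Adj u v →
      (u ∈ C ∨ v ∈ C) ∨ u = ⟨i, hin⟩ ∧ v = ⟨j, hjn⟩ := by
    intro u v huv ha
    by_cases h : (u : ℕ) = i ∧ (v : ℕ) = j
    · exact .inr ⟨Fin.ext h.1, Fin.ext h.2⟩
    · exact .inl (hcov u v (by omega) ha)
  have hcondiff : ((inst G h C).Adj i j ∧ ¬ (inst G h C).Cov i ∧ ¬ (inst G h C).Cov j) ↔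
      G.Adj ⟨i, hin⟩ ⟨j, hjn⟩ ∧ ⟨i, hin⟩ ∉ C ∧ ⟨j, hjn⟩ ∉ C := by
    rw [← inst_adj (h := h) (C := C), ← inst_cov (G := G) (h := h), ← inst_cov (G := G) (h := h)]
  dsimp only at hs₁
  refine .ite (fun hne => ?_) (fun heq => ?_)
  · split_ifs at hs₁ with hc
    swap
    · exact absurd hs₁ hne
    rw [hcondiff] at hc
    have hr₁ := hrs.of_sameBelow hpos hsb
    refine (hp₁ _ s₁ hr₁).seq fun s₂ ⟨hs₂, hreg₂⟩ => ?_
    have hm₂ : s₂.mem = coverMem G (insert ⟨i, hin⟩ C) := by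
      rw [hs₂, hsb.2, hm]
      exact update_coverMem (⟨i, hin⟩ : Fin n)
    have hreg : ∀ r < 6, s₂.reg r = s.reg r := fun r hr => (hreg₂ r hr).trans (hsb.1 r hr)
    have hr₂ := hrep s₂ _ ((hreg 0 (by omega)).trans h0) ((hreg 1 (by omega)).trans h1)
      ((hreg 2 (by omega)).trans hi2) ((hreg 4 (by omega)).trans hj4) hm₂
    refine (hp₂ _ s₂ hr₂).mono (Nat.le_sub_of_add_le ((Nat.le_succ _).trans (hcost₂ _))) fun s₃ ⟨hs₃, hreg₃⟩ => ?_
    have hreg' : ∀ r < 6, s₃.reg r = s.reg r := fun r hr => (hreg₃ r hr).trans (hreg r hr)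
    refine ⟨⟨(hreg' 0 (by omega)).trans h0, (hreg' 1 (by omega)).trans h1,
      insert ⟨j, hjn⟩ (insert ⟨i, hin⟩ C), ?_, hC.insert hc.1 hc.2.1 hc.2.2, ?_⟩, hreg'⟩
    · rw [hs₃, hm₂]
      exact update_coverMem (⟨j, hjn⟩ : Fin n)
    · intro u v huv ha
      rcases hadj u v huv ha with (hu | hv) | ⟨rfl, -⟩
      · exact .inl (Finset.mem_insert_of_mem (Finset.mem_insert_of_mem hu))
      · exact .inr (Finset.mem_insert_of_mem (Finset.mem_insert_of_mem hv))
      · exact .inl (Finset.mem_insert_of_mem (Finset.mem_insert_self _ _))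
  · split_ifs at hs₁ with hc
    · omega
    rw [hcondiff] at hc
    refine (Runs.const ?_).mono (by have := hcost₂ C; omega) fun _ => id
    have hreg : ∀ r < 6, (s₁.setReg 6 0).reg r = s.reg r :=
      (hsb.trans (sameBelow_setReg le_rfl)).1
    refine ⟨⟨(hreg 0 (by omega)).trans h0, (hreg 1 (by omega)).trans h1, C, hsb.2.trans hm, hC,
      fun u v huv ha => ?_⟩, hreg⟩
    rcases hadj u v huv ha with h | ⟨rfl, rfl⟩
    · exact h
    · exact or_iff_not_and_not.2 fun h => hc ⟨ha, h⟩

theorem greedy_cost_le (n A e : ℕ) :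
    1 + (n * (1 + (n * (A * (n + 1) ^ e + 4) + 2) + 4) + 2) ≤ (A + 20) * (n + 1) ^ (e + 2) := by
  have h1 : 1 ≤ (n + 1) ^ e := Nat.one_le_pow _ _ (by omega)
  rw [pow_add]
  generalize (n + 1) ^ e = x at *
  have : n * n * (A * x) ≤ (n + 1) ^ 2 * (A * x) := Nat.mul_le_mul_right _ (by nlinarith)
  have h2 : n * n * 4 + 7 * n + 3 ≤ 20 * (1 * (n + 1) ^ 2) := by nlinarith
  have h3 : 20 * (1 * (n + 1) ^ 2) ≤ 20 * (x * (n + 1) ^ 2) :=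
    Nat.mul_le_mul_left _ (Nat.mul_le_mul_right _ h1)
  nlinarith

/-- A program that computes a vertex cover. -/
theorem exists_cover : ∃ p A e, ∀ (n : ℕ) (G : SimpleGraph (Fin n)) (h : ℕ),
    Runs p (input G h) (A * (n + 1) ^ e) (fun s => s.reg 0 = n ∧ s.reg 1 = h ∧
      ∃ C : Finset (Fin n), s.mem = coverMem G C ∧ IsTight G C ∧ G.IsVertexCover C) := by
  obtain ⟨p, A, e, hp⟩ := exists_greedy_step
  -- Registers 3 and 5 receive the number of rounds. The outer loop uses register 4 for its constant
  -- 1, which is harmless because the inner loop starts by resetting its counter.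
  refine ⟨.seq (.copy 3 0) (forLoop 2 (.seq (.copy 5 0) (forLoop 4 p))), A + 20, e + 2,
    fun n G h => ?_⟩
  have hT := greedy_cost_le n A e
  refine ((Runs.copy (Q := fun s => s = (input G h).setReg 3 n) rfl).seq (T' :=
    n * (1 + (n * (A * (n + 1) ^ e + 4) + 2) + 4) + 2) ?_).mono hT fun _ => id
  rintro _ rfl
  refine (Runs.forLoop (b := n) (T := 1 + (n * (A * (n + 1) ^ e + 4) + 2))
    (I := fun i s => Greedy G h i 0 s) (fun i s s' H hr hm =>
    H.congr hr hm) ?_ (by simp) ?_).mono le_rfl ?_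
  · intro i hin s H hi
    refine (Runs.copy (Q := fun s' => s' = s.setReg 5 (s.reg 0)) rfl).seq
      (T' := n * (A * (n + 1) ^ e + 4) + 2) ?_
    rintro _ rfl
    refine (Runs.forLoop (b := n) (T := A * (n + 1) ^ e) (I := fun j s' => Greedy G h i j s' ∧ s'.reg 2 = i ∧
      s'.reg 3 = s.reg 3) ?_ ?_ ?_ ?_).mono le_rfl ?_
    · exact fun j s' s'' H hr hm => ⟨H.1.congr (fun r hr' => hr r (by omega)) hm,
        (hr 2 (by omega)).trans H.2.1, (hr 3 (by omega)).trans H.2.2⟩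
    · intro j hjn s' H' hj
      refine (hp n G h i j hin hjn s' H'.1 H'.2.1 hj).mono le_rfl fun s'' H'' => ?_
      exact ⟨⟨H''.1, (H''.2 2 (by omega)).trans H'.2.1, (H''.2 3 (by omega)).trans H'.2.2⟩,
        (H''.2 4 (by omega)).trans hj, H''.2 5 (by omega)⟩
    · simp [H.1]
    · refine ⟨H.congr (fun r hr => ?_) rfl, ?_, ?_⟩
      · simp [State.setReg, Function.update, show r ≠ 5 by omega]
      · simpa [State.setReg] using hi
      · simp [State.setReg]
    · rintro s' ⟨⟨h0, h1, C, hm, hC, hcov⟩, h2, h3⟩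
      exact ⟨⟨h0, h1, C, hm, hC, fun u v huv => hcov u v (by have := v.2; omega)⟩, h2, h3⟩
  · exact ⟨by simp [State.setReg, input], by simp [State.setReg, input], ∅, input_mem (h := h),
      fun S _ => by simp, fun u v huv => by omega⟩
  · rintro s ⟨h0, h1, C, hm, hC, hcov⟩
    exact ⟨h0, h1, C, hm, hC, fun u v => hcov u v (.inl u.2)⟩

end

end RAM

/-! ### The criteria and the two readings of "color class" -/

namespace RAM

/-- The criterion for at most `h` nonempty color classes. -/
def Inst.Accept (I : Inst) : Prop :=
  I.n = 0 ∨ ∃ g < I.n, g + 1 ≤ I.h ∧ I.Good (g + 1)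

/-- The criterion for `h` possibly empty color classes. -/
def Inst.AcceptFin (I : Inst) : Prop :=
  I.n ≤ I.h ∨ ∃ g < I.n, g + 1 = I.h ∧ I.Good (g + 1)

/-- The number of classes is a loop variable plus 1, hence at most `n`. The input `h` is unbounded
and enters only through comparisons, so the time does not depend on it. -/
theorem compP_good_succ : (searchCtx.ext fun I g => g < I.n).CompP
    (fun x => x.1.Good (x.2 + 1)) :=
  searchCtx_over.ext.good (.add .last (.const 1)) (fun _ _ => Nat.succ_pos _) (fun _ h => h.2)

theorem compP_accept : searchCtx.CompP Inst.Accept :=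
  (Ctx.CompP.eq_zero searchCtx_over.n).or (.ex (P := fun (I : Inst) (g : ℕ) => g + 1 ≤ I.h ∧ I.Good (g + 1))
    searchCtx_over.n searchCtx_over.n_le
    ((Ctx.CompP.le (.add .last (.const 1)) searchCtx_h.weaken).and compP_good_succ))

theorem compP_acceptFin : searchCtx.CompP Inst.AcceptFin :=
  (Ctx.CompP.le searchCtx_over.n searchCtx_h).or
    (.ex (P := fun (I : Inst) (g : ℕ) => g + 1 = I.h ∧ I.Good (g + 1)) searchCtx_over.n searchCtx_over.n_le
      ((Ctx.CompP.eq (.add .last (.const 1)) searchCtx_h.weaken).and compP_good_succ))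

end RAM

section

variable {V : Type*} {G : SimpleGraph V} {h : ℕ}

theorem EquitablyColorableFin.of_card_le [Fintype V] (hV : Fintype.card V ≤ h) :
    EquitablyColorableFin G h := by
  obtain ⟨e⟩ : Nonempty (V ↪ Fin h) :=
    Function.Embedding.nonempty_of_card_le (by simpa using hV)
  refine ⟨.mk e fun {v w} hvw he => hvw.ne (e.injective he), fun i j => ?_⟩
  refine le_trans ((Set.ncard_le_one_iff (Set.toFinite _)).2 fun {v w} hv hw => ?_) (Nat.le_add_left _ _)
  exact e.injective (Eq.trans hv (Eq.symm hw))

/-- Ignoring the colors not in use only removes comparisons. -/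
theorem EquitablyColorableFin.equitablyColorable {g : ℕ} (H : EquitablyColorableFin G g)
    (hg : g ≤ h) : EquitablyColorable G h := by
  obtain ⟨c, hc⟩ := H
  let c' : G.Coloring ℕ := .mk (fun v => c v) fun {v w} hvw he => c.valid hvw (Fin.ext he)
  have hc' : ∀ v, c'.colorClass (c' v) = c.colorClass (c v) := fun v => by
    ext w
    exact Fin.val_inj
  refine ⟨c', ?_, ?_⟩
  · have : Set.range c' ⊆ (Finset.range g : Set ℕ) := by
      rintro _ ⟨v, rfl⟩
      exact Finset.mem_coe.2 (Finset.mem_range.2 (c v).2)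
    refine (Set.ncard_le_ncard this (Finset.finite_toSet _)).trans ?_
    rwa [Set.ncard_coe_finset, Finset.card_range]
  · rintro _ ⟨v, rfl⟩ _ ⟨w, rfl⟩
    rw [hc', hc']
    exact hc _ _

/-- The colors in use are renumbered; there are no more of them than vertices. -/
theorem EquitablyColorable.exists_fin [Fintype V] [Nonempty V] (H : EquitablyColorable G h) :
    ∃ g, 0 < g ∧ g ≤ Fintype.card V ∧ g ≤ h ∧ EquitablyColorableFin G g := by
  obtain ⟨c, hch, hc⟩ := H
  have hfin : (Set.range c).Finite := Set.finite_range c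
  refine ⟨(Set.range c).ncard, ?_, ?_, hch, ?_⟩
  · exact (Set.ncard_pos hfin).2 (Set.range_nonempty c)
  · rw [← Set.image_univ, ← Nat.card_eq_fintype_card, ← Set.ncard_univ]
    exact Set.ncard_image_le Set.finite_univ
  · have : Fintype (Set.range c) := hfin.fintype
    let e : Set.range c ≃ Fin (Set.range c).ncard := Fintype.equivFinOfCardEq (by
      rw [← Nat.card_eq_fintype_card]; rfl)
    let c' : G.Coloring (Fin (Set.range c).ncard) := .mk (fun v => e ⟨c v, v, rfl⟩)
      fun {v w} hvw he => c.valid hvw (congrArg Subtype.val (e.injective he))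
    have hc' : ∀ i, c'.colorClass i = c.colorClass (e.symm i) := fun i => by
      ext v
      change e ⟨c v, v, rfl⟩ = i ↔ c v = e.symm i
      rw [← Equiv.eq_symm_apply, Subtype.ext_iff]
    refine ⟨c', fun i j => ?_⟩
    rw [hc', hc']
    exact hc _ (e.symm i).2 _ (e.symm j).2

end

/-! ### Correctness of the criteria and the total running time -/

namespace RAM

variable {n : ℕ} {G : SimpleGraph (Fin n)} {h : ℕ} {C : Finset (Fin n)}

theorem accept_iff (hC : G.IsVertexCover C) :
    (inst G h C).Accept ↔ EquitablyColorable G h := by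
  constructor
  · rintro (hn | ⟨g, -, hgh, hg⟩)
    · obtain rfl : n = 0 := hn
      exact ⟨.mk (fun _ => 0) fun {v} => v.elim0, by simp, by simp⟩
    · exact ((good_iff hC (Nat.succ_pos _)).1 hg).equitablyColorable hgh
  · intro H
    rcases Nat.eq_zero_or_pos n with hn | hn
    · exact .inl hn
    · have : Nonempty (Fin n) := ⟨⟨0, hn⟩⟩
      obtain ⟨g, hg0, hgn, hgh, hg⟩ := H.exists_fin
      rw [Fintype.card_fin] at hgn
      obtain ⟨g, rfl⟩ := Nat.exists_eq_succ_of_ne_zero hg0.ne'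
      exact .inr ⟨g, hgn, hgh, (good_iff hC hg0).2 hg⟩

/-- For `n ≤ h` distinct colors give classes of size at most 1. Otherwise `h` itself is within the
range of the search. -/
theorem acceptFin_iff (hC : G.IsVertexCover C) (hh : 0 < h) :
    (inst G h C).AcceptFin ↔ EquitablyColorableFin G h := by
  constructor
  · rintro (hn | ⟨g, -, hgh, hg⟩)
    · exact .of_card_le (by rw [Fintype.card_fin]; exact hn)
    · obtain rfl : g + 1 = h := hgh
      exact (good_iff hC (Nat.succ_pos _)).1 hg
  · intro H
    by_cases hn : n ≤ h
    · exact .inl hn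
    · obtain ⟨g, rfl⟩ := Nat.exists_eq_succ_of_ne_zero hh.ne'
      exact .inr ⟨g, by change g < n; omega, rfl, (good_iff hC hh).2 H⟩

/-- Apply tightness to a minimum vertex cover. -/
theorem IsTight.card_le {k : ℕ} (hC : IsTight G C) (hk : G.vertexCoverNum = (k : ℕ∞)) :
    C.card ≤ 2 * k := by
  classical
  obtain ⟨S, hS, hcov⟩ := G.vertexCoverNum_exists
  have h1 := hC S.toFinset (by simpa using hcov)
  have h2 : S.toFinset.card = k := by
    rw [hk, ← Set.coe_toFinset S, Set.encard_coe_eq_coe_finsetCard] at hS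
    exact_mod_cast hS
  have h3 := Finset.card_le_card (Finset.inter_subset_left (s₁ := S.toFinset) (s₂ := C))
  omega

theorem bound_inst_le {k : ℕ} (hC : C.card ≤ 2 * k) :
    (inst G h C).bound + 1 ≤ 7 * (2 ^ (8 * k ^ 2) * max n 1) := by
  have h1 : (inst G h C).bound = n + 1 + 2 ^ (C.card + 1) ^ 2 := by
    rw [Inst.bound, show (inst G h C).n = n from rfl, inst_idx]
  have h2 : 2 ^ (C.card + 1) ^ 2 ≤ 4 * 2 ^ (8 * k ^ 2) := by
    rw [show 4 = 2 ^ 2 from rfl, ← pow_add]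
    -- The exponents satisfy (2k + 1)^2 ≤ 8k^2 + 2, because (2k - 1)^2 ≥ 0.
    refine Nat.pow_le_pow_right two_pos ((Nat.pow_le_pow_left (Nat.succ_le_succ hC) 2).trans ?_)
    rcases k.eq_zero_or_pos with rfl | hk
    · norm_num
    · simp only [Nat.succ_eq_add_one]
      nlinarith
  have h3 : 1 ≤ 2 ^ (8 * k ^ 2) := Nat.one_le_two_pow
  have h4 : n ≤ max n 1 := le_max_left _ _
  have h5 : 1 ≤ max n 1 := le_max_right _ _
  rw [h1]
  generalize 2 ^ (8 * k ^ 2) = x at *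
  generalize max n 1 = N at *
  nlinarith

/-- Decision of a computable criterion after the computation of a vertex cover. -/
theorem exists_decidesWithin {P : Inst → Prop} (hP : searchCtx.CompP P)
    (Q : (n : ℕ) → SimpleGraph (Fin n) → ℕ → Prop)
    (hPQ : ∀ n (G : SimpleGraph (Fin n)) h (C : Finset (Fin n)), 0 < h → G.IsVertexCover C →
      (P (inst G h C) ↔ Q n G h)) :
    ∃ (p : Prog) (A c d : ℕ), ∀ (n : ℕ) (G : SimpleGraph (Fin n)) (h k : ℕ),
      0 < h → G.vertexCoverNum = (k : ℕ∞) →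
        DecidesWithin p (input G h) (Q n G h) (A * 2 ^ (c * k ^ 2) * (max n 1) ^ d) := by
  obtain ⟨p₁, A₁, e₁, h₁⟩ := exists_cover
  -- `n` and `h` are read from registers 0 and 1, where the first phase leaves them; the answer
  -- appears in register 2.
  obtain ⟨p₂, T, ⟨A₂, e₂, hT⟩, h₂⟩ := hP id 2 (fun r hr => hr)
  refine ⟨.seq p₁ (.seq p₂ (.copy 0 2)), A₁ * 7 ^ e₁ + (A₂ * 7 ^ e₂ + 1), 8 * (e₁ + e₂), e₁ + e₂,
    fun n G h k hh hk => ?_⟩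
  have hrun : Runs (.seq p₁ (.seq p₂ (.copy 0 2))) (input G h)
      (A₁ * (n + 1) ^ e₁ + (A₂ * (7 * (2 ^ (8 * k ^ 2) * max n 1)) ^ e₂ + 1))
      (fun s => (Q n G h → s.reg 0 = 1) ∧ (¬ Q n G h → s.reg 0 = 0)) := by
    refine (h₁ n G h).seq fun s ⟨hn, hh', C, hm, htight, hC⟩ => ?_
    have hrep : searchCtx.Rep id (inst G h C) s := by
      refine ⟨trivial, fun r hr => ?_, hm⟩
      have hr : r < 2 := hr
      interval_cases r
      exacts [hn, hh']
    refine ((h₂ _ s hrep).mono ((hT _ trivial).trans (Nat.mul_le_mul_left _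
      (Nat.pow_le_pow_left (bound_inst_le (htight.card_le hk)) _))) fun _ => id).seq
      fun s' ⟨hs', _⟩ => .copy ?_
    dsimp only at hs'
    rw [← hPQ n G h C hh hC]
    exact ⟨fun hp => by simp [hs', hp], fun hp => by simp [hs', hp]⟩
  obtain ⟨t, s', he, ht, hq⟩ := hrun
  refine ⟨t, s', he, ht.trans ?_, hq⟩
  have hb : 1 ≤ 2 ^ (8 * k ^ 2) * max n 1 :=
    Nat.mul_pos (Nat.two_pow_pos _) (lt_max_of_lt_right one_pos)
  have hn1 : n + 1 ≤ 7 * (2 ^ (8 * k ^ 2) * max n 1) := by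
    have : max n 1 ≤ 2 ^ (8 * k ^ 2) * max n 1 := Nat.le_mul_of_pos_left _ (Nat.two_pow_pos _)
    omega
  have htot : (2 ^ (8 * k ^ 2) * max n 1) ^ (e₁ + e₂) =
      2 ^ (8 * (e₁ + e₂) * k ^ 2) * max n 1 ^ (e₁ + e₂) := by
    rw [mul_pow, ← pow_mul]
    ring_nf
  rw [mul_assoc, ← htot]
  -- Both `n + 1` and the search bound plus 1 are at most `7 * B`, so `B ^ (e₁ + e₂)` absorbs the
  -- costs of both phases.
  generalize 2 ^ (8 * k ^ 2) * max n 1 = B at *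
  have b1 : A₁ * (n + 1) ^ e₁ ≤ A₁ * 7 ^ e₁ * B ^ (e₁ + e₂) := by
    rw [mul_assoc]
    refine Nat.mul_le_mul_left _ ((Nat.pow_le_pow_left hn1 _).trans ?_)
    rw [mul_pow]
    exact Nat.mul_le_mul_left _ (Nat.pow_le_pow_right hb (Nat.le_add_right _ _))
  have b2 : A₂ * (7 * B) ^ e₂ ≤ A₂ * 7 ^ e₂ * B ^ (e₁ + e₂) := by
    rw [mul_assoc, mul_pow]
    exact Nat.mul_le_mul_left _
      (Nat.mul_le_mul_left _ (Nat.pow_le_pow_right hb (Nat.le_add_left _ _)))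
  have b3 : 1 ≤ B ^ (e₁ + e₂) := Nat.one_le_pow _ _ hb
  rw [add_mul, add_mul, one_mul]
  omega

end RAM

theorem mainTheorem8 :
    (∃ (P : RAM.Prog) (A c d : ℕ), ∀ (n : ℕ) (G : SimpleGraph (Fin n)) (h k : ℕ),
      0 < h → G.vertexCoverNum = (k : ℕ∞) →
        RAM.DecidesWithin P (RAM.input G h) (EquitablyColorable G h)
          (A * 2 ^ (c * k ^ 2) * (max n 1) ^ d)) ∧
    (∃ (P : RAM.Prog) (A c d : ℕ), ∀ (n : ℕ) (G : SimpleGraph (Fin n)) (h k : ℕ),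
      0 < h → G.vertexCoverNum = (k : ℕ∞) →
        RAM.DecidesWithin P (RAM.input G h) (EquitablyColorableFin G h)
          (A * 2 ^ (c * k ^ 2) * (max n 1) ^ d)) :=
  ⟨RAM.exists_decidesWithin RAM.compP_accept (fun _ G h => EquitablyColorable G h)
      fun _ _ _ _ _ hC => RAM.accept_iff hC,
    RAM.exists_decidesWithin RAM.compP_acceptFin (fun _ G h => EquitablyColorableFin G h)
      fun _ _ _ _ hh hC => RAM.acceptFin_iff hC hh⟩
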